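/- Let $\mathcal G=(S,E)$ be a finite simple graph. Let $V$ be the $\mathbb Q$-vector space with basis $S$, let $W\subseteq\bigwedge^2V$ be the span of all $\alpha\wedge\beta$ with $\alpha\beta\in E$, and let $\mathfrak n^{\mathbb Q}_{\mathcal G}=V\oplus W$ be the Lie algebra over $\mathbb Q$ with $[\alpha,\beta]=\alpha\wedge\beta$ for $\alpha,\beta\in S$ with $\alpha\beta\in E$, $[\alpha,\beta]=0$ for $\alpha,\beta\in S$ with $\alpha\beta\notin E$, and $[u,v]=0$ whenever $u\in W$ or $v\in W$. For $\alpha\in S$ put $\Omega'(\alpha)=\{\beta\in S\mid\alpha\beta\in E\}$ and $\Omega(\alpha)=\Omega'(\alpha)\cup\{\alpha\}$. The coherent components $\lambda_1,\dots,\lambda_k$ of $\mathcal G$ are the classes of the equivalence relation $\alpha\sim\beta\iff\Omega'(\alpha)\subseteq\Omega(\beta)$ and $\Omega'(\beta)\subseteq\Omega(\alpha)$ on $S$, and $V_{\lambda_i}\subseteq V$ is the span of $\lambda_i$. For a graph automorphism $\sigma$ of $\mathcal G$ let $P_\sigma\in \mathrm{GL}(V)$ be the map with $P_\sigma(\alpha)=\sigma(\alpha)$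 for $\alpha\in S$. Let $L\le\mathrm{Aut}(\mathfrak n^{\mathbb Q}_{\mathcal G})$ be the subgroup of all automorphisms that preserve $V$ and whose restriction to $V$ lies in $P(\mathrm{Aut}(\mathcal G))\prod_{i=1}^k\mathrm{GL}(V_{\lambda_i})$, where $\prod_{i=1}^k\mathrm{GL}(V_{\lambda_i})$ is embedded in $\mathrm{GL}(V)$ through $V=\bigoplus_iV_{\lambda_i}$. Let $H$ be a finite group and $\rho:H\to L\le\mathrm{Aut}(\mathfrak n^{\mathbb Q}_{\mathcal G})$ a homomorphism. Then $H$ acts on the set of coherent components by $\rho(h)(V_\lambda)=V_{h\cdot\lambda}$. For $1\le i\le k$ let $H_i=\{h\in H\mid\rho(h)(V_{\lambda_i})=V_{\lambda_i}\}$, let $\rho_i:H_i\to\mathrm{GL}(V_{\lambda_i})$ be the representation obtained by restriction, and let $c(\lambda_i)=2$ if two vertices in the union of the coherent components in the orbit $H\cdot\lambda_i$ are adjacent in $\mathcal G$, and $c(\lambda_i)=1$ otherwise. A linear automorphism of a finite-dimensional rational vector space is called integer-like if its characteristic polynomial has coefficients in $\mathbb Z$ and constant term $\pm1$, and $c$-hyperbolic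 if, for all $1\le l\le c$ and all complex eigenvalues $\mu_1,\dots,\mu_l$ (repetitions allowed), $\prod_{j=1}^l|\mu_j|\ne1$. An automorphism of $\mathfrak n^{\mathbb Q}_{\mathcal G}$ is called Anosov if it is integer-like and hyperbolic, i.e. has no complex eigenvalue of absolute value $1$. Then the following are equivalent. 1. There exists an Anosov automorphism $\varphi\in\mathrm{Aut}(\mathfrak n^{\mathbb Q}_{\mathcal G})$ commuting with every element of $\rho(H)$. 2. For every $1\le i\le k$ there exists a $c(\lambda_i)$-hyperbolic integer-like automorphism $\varphi_i\in\mathrm{GL}(V_{\lambda_i})$ commuting with every element of $\rho_i(H_i)$. -/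

import Mathlib

open scoped Polynomial

set_option linter.unusedSectionVars false

universe u v

/-! ### The group of automorphisms of a Lie algebra -/

/-- The Lie algebra automorphisms form a group under composition: `(f * g) x = f (g x)`. -/
instance LieEquiv.instGroupAut {R : Type u} {L : Type v} [CommRing R] [LieRing L]
    [LieAlgebra R L] : Group (L ≃ₗ⁅R⁆ L) where
  mul f g := g.trans f
  one := 1
  inv f := f.symm
  mul_assoc _ _ _ := rfl
  one_mul _ := rfl
  mul_one _ := rfl
  inv_mul_cancel f := LieEquiv.ext fun x => f.symm_apply_apply x

/-! ### Integer-like and `c`-hyperbolic maps -/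

/-- The characteristic polynomial has integer coefficients and constant term `1` or `-1`. -/
def IsIntegerLike {M : Type u} [AddCommGroup M] [Module ℚ M] [Module.Finite ℚ M]
    (f : M →ₗ[ℚ] M) : Prop :=
  ∃ q : ℤ[X], q.map (Int.castRingHom ℚ) = f.charpoly ∧ (q.coeff 0 = 1 ∨ q.coeff 0 = -1)

/-- For every `1 ≤ l ≤ c` and all complex eigenvalues `μ 1, …, μ l` of `f` (repetitions allowed),
`|μ 1| ⋯ |μ l| ≠ 1`. -/
def IsHyperbolicOfClass {M : Type u} [AddCommGroup M] [Module ℚ M] [Module.Finite ℚ M]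
    (c : ℕ) (f : M →ₗ[ℚ] M) : Prop :=
  ∀ l : ℕ, 1 ≤ l → l ≤ c → ∀ μ : Fin l → ℂ,
    (∀ j, μ j ∈ f.charpoly.aroots ℂ) → ∏ j, ‖μ j‖ ≠ 1

/-- No complex eigenvalue of `f` has absolute value `1`. -/
def IsHyperbolicMap {M : Type u} [AddCommGroup M] [Module ℚ M] [Module.Finite ℚ M]
    (f : M →ₗ[ℚ] M) : Prop :=
  ∀ μ ∈ f.charpoly.aroots ℂ, ‖μ‖ ≠ 1

/-- Anosov automorphisms of a rational Lie algebra: hyperbolic and integer-like. -/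
def IsAnosov {L : Type u} [LieRing L] [LieAlgebra ℚ L] [Module.Finite ℚ L]
    (φ : L ≃ₗ⁅ℚ⁆ L) : Prop :=
  IsHyperbolicMap (φ.toLinearEquiv : L →ₗ[ℚ] L) ∧ IsIntegerLike (φ.toLinearEquiv : L →ₗ[ℚ] L)

namespace GraphLie

section LieAlgebraOfGraph

variable {S : Type u} [Fintype S] [DecidableEq S] (G : SimpleGraph S)

/-! ### The rational 2-step nilpotent Lie algebra of a graph -/

/-- The wedge `a ∧ b` of two vertices in `⋀² V`, where `V = S → ℚ` is the vector space with
standard basis `S`. -/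
noncomputable def wedge (a b : S) : ⋀[ℚ]^2 (S → ℚ) :=
  exteriorPower.ιMulti ℚ 2 ![Pi.single a 1, Pi.single b 1]

/-- The subspace `W` of `⋀² V` spanned by the wedges `a ∧ b` with `ab` an edge. -/
noncomputable def edgeSpace : Submodule ℚ (⋀[ℚ]^2 (S → ℚ)) :=
  Submodule.span ℚ {w | ∃ a b : S, G.Adj a b ∧ w = wedge a b}

/-- The space `W`, as a type. -/
def W : Type u := edgeSpace G

noncomputable instance : AddCommGroup (W G) :=
  Submodule.addCommGroup (edgeSpace G)

noncomputable instance : Module ℚ (W G) :=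
  Submodule.module (edgeSpace G)

instance : Module.Finite ℚ (W G) :=
  inferInstanceAs (Module.Finite ℚ (edgeSpace G))

variable {G} in
lemma wedge_mem {a b : S} (h : G.Adj a b) : wedge a b ∈ edgeSpace G :=
  Submodule.subset_span ⟨a, b, h, rfl⟩

variable {G} in
/-- The element `a ∧ b` of `W`, for an edge `ab`. -/
noncomputable def edgeWedge {a b : S} (h : G.Adj a b) : W G :=
  (⟨wedge a b, wedge_mem h⟩ : edgeSpace G)

open Classical in
/-- The bracket of two basis vectors: `a ∧ b` if `ab` is an edge, and `0` otherwise. -/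
noncomputable def basisBracket (a b : S) : W G :=
  if h : G.Adj a b then edgeWedge h else 0

/-- The underlying space `V ⊕ W` of the Lie algebra `n_G` over `ℚ`. -/
def LieAlg : Type u := (S → ℚ) × W G

noncomputable instance : AddCommGroup (LieAlg G) :=
  inferInstanceAs (AddCommGroup ((S → ℚ) × W G))

noncomputable instance : Module ℚ (LieAlg G) :=
  inferInstanceAs (Module ℚ ((S → ℚ) × W G))

instance : Module.Finite ℚ (LieAlg G) :=
  inferInstanceAs (Module.Finite ℚ ((S → ℚ) × W G))

/-- The inclusion of `V` into `n_G = V ⊕ W`. -/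
noncomputable def inclV : (S → ℚ) →ₗ[ℚ] LieAlg G := LinearMap.inl ℚ (S → ℚ) (W G)

/-- The inclusion of `W` into `n_G = V ⊕ W`. -/
noncomputable def inclW : W G →ₗ[ℚ] LieAlg G := LinearMap.inr ℚ (S → ℚ) (W G)

/-- The projection of `n_G = V ⊕ W` onto `V`. -/
noncomputable def projV : LieAlg G →ₗ[ℚ] (S → ℚ) := LinearMap.fst ℚ (S → ℚ) (W G)

@[simp] lemma projV_inclV (v : S → ℚ) : projV G (inclV G v) = v := rfl
@[simp] lemma projV_inclW (w : W G) : projV G (inclW G w) = 0 := rfl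

lemma inclV_injective : Function.Injective (inclV G) :=
  Function.LeftInverse.injective (projV_inclV G)

lemma wedge_swap (a b : S) : wedge b a = - wedge a b := by
  have h := (exteriorPower.ιMulti ℚ 2 (M := S → ℚ)).map_swap
    ![Pi.single a 1, Pi.single b 1] (i := 0) (j := 1) (by decide)
  unfold wedge
  rw [← h]
  congr 1
  ext i
  fin_cases i <;> rfl

lemma basisBracket_swap (a b : S) : basisBracket G b a = - basisBracket G a b := by
  unfold basisBracket
  by_cases h : G.Adj a b
  · rw [dif_pos h, dif_pos h.symm]
    exact Subtype.ext (wedge_swap a b)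
  · rw [dif_neg h, dif_neg fun h' => h h'.symm, neg_zero]

/-- The bilinear extension of `basisBracket` to `V`. -/
noncomputable def bracketV (x y : S → ℚ) : W G :=
  ∑ a, ∑ b, (x a * y b) • basisBracket G a b

lemma bracketV_swap (x y : S → ℚ) : bracketV G y x = - bracketV G x y := by
  unfold bracketV
  rw [Finset.sum_comm, ← Finset.sum_neg_distrib]
  refine Finset.sum_congr rfl fun a _ => ?_
  rw [← Finset.sum_neg_distrib]
  refine Finset.sum_congr rfl fun b _ => ?_
  rw [basisBracket_swap, smul_neg, mul_comm]

lemma bracketV_self (x : S → ℚ) : bracketV G x x = 0 := by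
  have h := bracketV_swap G x x
  have h2 : (2 : ℚ) • bracketV G x x = 0 := by
    rw [two_smul]; nth_rewrite 1 [h]; exact neg_add_cancel _
  exact (smul_eq_zero.1 h2).resolve_left two_ne_zero

lemma bracketV_add_left (x y z : S → ℚ) :
    bracketV G (x + y) z = bracketV G x z + bracketV G y z := by
  simp only [bracketV, Pi.add_apply, add_mul, add_smul, Finset.sum_add_distrib]

lemma bracketV_add_right (x y z : S → ℚ) :
    bracketV G x (y + z) = bracketV G x y + bracketV G x z := by
  simp only [bracketV, Pi.add_apply, mul_add, add_smul, Finset.sum_add_distrib]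

lemma bracketV_smul_right (t : ℚ) (x y : S → ℚ) :
    bracketV G x (t • y) = t • bracketV G x y := by
  simp only [bracketV, Pi.smul_apply, smul_eq_mul, Finset.smul_sum, smul_smul]
  refine Finset.sum_congr rfl fun a _ => Finset.sum_congr rfl fun b _ => ?_
  congr 1
  ring

lemma bracketV_zero_left (y : S → ℚ) : bracketV G 0 y = 0 := by simp [bracketV]

lemma bracketV_zero_right (x : S → ℚ) : bracketV G x 0 = 0 := by simp [bracketV]

lemma bracketV_single (a b : S) :
    bracketV G (Pi.single a 1) (Pi.single b 1) = basisBracket G a b := by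
  unfold bracketV
  rw [Finset.sum_eq_single a, Finset.sum_eq_single b]
  · simp
  · intro b' _ hb; simp [hb]
  · simp
  · intro a' _ ha; simp [ha]
  · simp

/-- The Lie bracket of `n_G`: it is `bracketV` on `V`, and vanishes if an argument lies in `W`. -/
noncomputable instance : LieRing (LieAlg G) where
  bracket x y := inclW G (bracketV G (projV G x) (projV G y))
  add_lie x y z := by
    change inclW G _ = inclW G _ + inclW G _
    rw [map_add, bracketV_add_left, map_add]
  lie_add x y z := by
    change inclW G _ = inclW G _ + inclW G _
    rw [map_add, bracketV_add_right, map_add]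
  lie_self x := by
    change inclW G _ = 0
    rw [bracketV_self, map_zero]
  leibniz_lie x y z := by
    change inclW G _ = inclW G _ + inclW G _
    simp only [projV_inclW, bracketV_zero_left, bracketV_zero_right, map_zero, add_zero]

lemma lie_def (x y : LieAlg G) :
    ⁅x, y⁆ = inclW G (bracketV G (projV G x) (projV G y)) := rfl

/-- The defining relations: `[a, b] = a ∧ b` if `ab` is an edge, and `[a, b] = 0` otherwise. -/
lemma lie_basis (a b : S) :
    ⁅inclV G (Pi.single a 1), inclV G (Pi.single b 1)⁆ = inclW G (basisBracket G a b) := by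
  rw [lie_def, projV_inclV, projV_inclV, bracketV_single]

noncomputable instance : LieAlgebra ℚ (LieAlg G) where
  lie_smul t x y := by
    rw [lie_def, lie_def, map_smul, bracketV_smul_right, map_smul]

end LieAlgebraOfGraph

section Components

variable {S : Type u} (G : SimpleGraph S)

/-! ### Coherent components -/

/-- `a ≺ b`: the open neighbourhood of `a` is contained in the closed neighbourhood of `b`. -/
def Prec (a b : S) : Prop := G.neighborSet a ⊆ insert b (G.neighborSet b)

lemma prec_refl (a : S) : Prec G a a := Set.subset_insert _ _

lemma prec_trans {a b c : S} (hab : Prec G a b) (hbc : Prec G b c) : Prec G a c := by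
  intro x hx
  rcases hab hx with rfl | hx'
  · rcases hbc (show a ∈ G.neighborSet x from SimpleGraph.Adj.symm hx) with rfl | h
    · exact Or.inr hx
    · rcases hab (show c ∈ G.neighborSet a from SimpleGraph.Adj.symm h) with rfl | h'
      · exact Or.inl rfl
      · exact Or.inr (SimpleGraph.Adj.symm h')
  · exact hbc hx'

/-- `a ∼ b` if and only if `a ≺ b` and `b ≺ a`. -/
def coherent : Setoid S where
  r a b := Prec G a b ∧ Prec G b a
  iseqv :=
    ⟨fun a => ⟨prec_refl G a, prec_refl G a⟩, fun h => ⟨h.2, h.1⟩,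
      fun h k => ⟨prec_trans G h.1 k.1, prec_trans G k.2 h.2⟩⟩

/-- The set of coherent components of `G`. -/
def Component : Type u := Quotient (coherent G)

/-- The coherent component of a vertex. -/
def toComponent (a : S) : Component G := Quotient.mk (coherent G) a

lemma prec_map (σ : G ≃g G) {a b : S} (h : Prec G a b) : Prec G (σ a) (σ b) := by
  intro x hx
  obtain ⟨y, rfl⟩ := σ.surjective x
  have hy : y ∈ G.neighborSet a := σ.map_adj_iff.1 hx
  rcases h hy with rfl | h'
  · exact Or.inl rfl
  · exact Or.inr (σ.map_adj_iff.2 h')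

/-- The map on coherent components induced by a graph automorphism. -/
def componentMap (σ : G ≃g G) : Component G → Component G :=
  Quotient.map (sa := coherent G) (sb := coherent G) σ
    fun _ _ h => ⟨prec_map G σ h.1, prec_map G σ h.2⟩

lemma componentMap_toComponent (σ : G ≃g G) (a : S) :
    componentMap G σ (toComponent G a) = toComponent G (σ a) := rfl

end Components

section Levi

variable {S : Type u} [Fintype S] [DecidableEq S] (G : SimpleGraph S)

/-! ### The subspaces `V_lam` and the Levi subgroup -/

/-- The subspace of `V` spanned by the vertices in a coherent component. -/
noncomputable def compV (lam : Component G) : Submodule ℚ (S → ℚ) :=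
  Submodule.span ℚ {v | ∃ a : S, toComponent G a = lam ∧ v = Pi.single a 1}

/-- The same subspace, seen inside the Lie algebra `n_G = V ⊕ W`. -/
noncomputable def comp (lam : Component G) : Submodule ℚ (LieAlg G) :=
  (compV G lam).map (inclV G)

/-- The permutation map `P σ : V → V`, which sends the basis vector `a` to `σ a`. -/
noncomputable def permV (σ : G ≃g G) : (S → ℚ) ≃ₗ[ℚ] (S → ℚ) :=
  LinearEquiv.funCongrLeft ℚ ℚ σ.symm.toEquiv

lemma permV_single (σ : G ≃g G) (a : S) :
    permV G σ (Pi.single a 1) = Pi.single (σ a) 1 := by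
  ext x
  have : (σ.symm x = a) ↔ (x = σ a) := by
    constructor
    · rintro rfl; exact (σ.apply_symm_apply x).symm
    · rintro rfl; exact σ.symm_apply_apply a
  change (Pi.single a (1 : ℚ) : S → ℚ) (σ.symm x) = _
  simp only [Pi.single_apply, this]

lemma permV_symm (σ : G ≃g G) : permV G σ.symm = (permV G σ).symm := rfl

lemma permV_mul (σ τ : G ≃g G) (v : S → ℚ) :
    permV G (τ.trans σ) v = permV G σ (permV G τ v) := rfl

lemma permV_mem (σ : G ≃g G) {lam : Component G} {v : S → ℚ} (hv : v ∈ compV G lam) :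
    permV G σ v ∈ compV G (componentMap G σ lam) := by
  have h : compV G lam ≤ (compV G (componentMap G σ lam)).comap (permV G σ).toLinearMap := by
    refine Submodule.span_le.2 ?_
    rintro _ ⟨a, rfl, rfl⟩
    refine Submodule.subset_span ⟨σ a, rfl, ?_⟩
    exact permV_single G σ a
  exact h hv

lemma componentMap_symm (σ : G ≃g G) (lam : Component G) :
    componentMap G σ.symm (componentMap G σ lam) = lam := by
  induction lam using Quotient.inductionOn with
  | _ a =>
    change toComponent G (σ.symm (σ a)) = toComponent G a
    rw [σ.symm_apply_apply]

/-- Membership in the product of the groups `GL(V_lam)`, embedded in `GL(V)`: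
`g` restricts to an automorphism of every `V_lam`. -/
def IsBlock (g : (S → ℚ) ≃ₗ[ℚ] (S → ℚ)) : Prop :=
  ∀ lam : Component G, (compV G lam).map g.toLinearMap = compV G lam

variable {G} in
lemma IsBlock.mem {g : (S → ℚ) ≃ₗ[ℚ] (S → ℚ)} (hg : IsBlock G g) {lam : Component G}
    {v : S → ℚ} (hv : v ∈ compV G lam) : g v ∈ compV G lam := by
  rw [← hg lam]
  exact Submodule.mem_map_of_mem hv

variable {G} in
lemma IsBlock.symm_mem {g : (S → ℚ) ≃ₗ[ℚ] (S → ℚ)} (hg : IsBlock G g) {lam : Component G}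
    {v : S → ℚ} (hv : v ∈ compV G lam) : g.symm v ∈ compV G lam := by
  rw [← hg lam] at hv
  obtain ⟨w, hw, rfl⟩ := hv
  simpa using hw

lemma isBlock_of_mem {g : (S → ℚ) ≃ₗ[ℚ] (S → ℚ)}
    (h₁ : ∀ lam, ∀ v ∈ compV G lam, g v ∈ compV G lam)
    (h₂ : ∀ lam, ∀ v ∈ compV G lam, g.symm v ∈ compV G lam) : IsBlock G g := by
  intro lam
  refine le_antisymm ?_ fun v hv => ⟨g.symm v, h₂ lam v hv, g.apply_symm_apply v⟩
  rintro _ ⟨v, hv, rfl⟩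
  exact h₁ lam v hv

lemma isBlock_conj {g : (S → ℚ) ≃ₗ[ℚ] (S → ℚ)} (hg : IsBlock G g) (σ : G ≃g G) :
    IsBlock G (((permV G σ).trans g).trans (permV G σ.symm)) := by
  refine isBlock_of_mem G (fun lam v hv => ?_) (fun lam v hv => ?_)
  · have := permV_mem G σ.symm (hg.mem (permV_mem G σ hv))
    rwa [componentMap_symm] at this
  · have := permV_mem G σ.symm (hg.symm_mem (permV_mem G σ hv))
    rwa [componentMap_symm] at this

/-- The Levi subgroup `L = P(Aut G) · ∏ GL(V_lam)` of `Aut(n_G)`: the automorphisms that preserve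
`V` and act on it as `P σ ∘ g`, where `σ` is a graph automorphism and `g` lies in `∏ GL(V_lam)`. -/
noncomputable def levi : Subgroup (LieAlg G ≃ₗ⁅ℚ⁆ LieAlg G) where
  carrier := {φ | ∃ (σ : G ≃g G) (g : (S → ℚ) ≃ₗ[ℚ] (S → ℚ)), IsBlock G g ∧
    ∀ v : S → ℚ, φ (inclV G v) = inclV G (permV G σ (g v))}
  one_mem' := ⟨RelIso.refl _, LinearEquiv.refl ℚ _, fun lam => Submodule.map_id _, fun _ => rfl⟩
  mul_mem' := by
    rintro φ ψ ⟨σ, g, hg, hφ⟩ ⟨τ, k, hk, hψ⟩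
    refine ⟨τ.trans σ, k.trans (((permV G τ).trans g).trans (permV G τ.symm)),
      isBlock_of_mem G (fun lam v hv => (isBlock_conj G hg τ).mem (hk.mem hv))
        (fun lam v hv => hk.symm_mem ((isBlock_conj G hg τ).symm_mem hv)), fun v => ?_⟩
    change φ (ψ (inclV G v)) = _
    rw [hψ, hφ, permV_mul, permV_symm]
    simp
  inv_mem' := by
    rintro φ ⟨σ, g, hg, hφ⟩
    have hg' : IsBlock G g.symm :=
      isBlock_of_mem G (fun lam v hv => hg.symm_mem hv) (fun lam v hv => hg.mem hv)
    refine ⟨σ.symm, ((permV G σ.symm).trans g.symm).trans (permV G σ.symm.symm),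
      isBlock_conj G hg' σ.symm, fun v => ?_⟩
    change φ.symm (inclV G v) = _
    rw [LieEquiv.symm_apply_eq, hφ]
    simp [permV_symm]

lemma single_mem_compV_iff (a : S) (lam : Component G) :
    (Pi.single a 1 : S → ℚ) ∈ compV G lam ↔ toComponent G a = lam := by
  refine ⟨fun h => ?_, fun h => Submodule.subset_span ⟨a, h, rfl⟩⟩
  by_contra hne
  have hle : compV G lam ≤ LinearMap.ker (LinearMap.proj a : (S → ℚ) →ₗ[ℚ] ℚ) := by
    refine Submodule.span_le.2 ?_
    rintro _ ⟨b, hb, rfl⟩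
    have hab : a ≠ b := fun e => hne (e ▸ hb)
    simp [hab]
  have := hle h
  simp at this

lemma comp_injective : Function.Injective (comp G) := by
  intro lam mu h
  have h' : compV G lam = compV G mu := Submodule.map_injective_of_injective (inclV_injective G) h
  induction lam using Quotient.inductionOn with
  | _ a =>
    have ha : (Pi.single a 1 : S → ℚ) ∈ compV G (toComponent G a) :=
      (single_mem_compV_iff G a _).2 rfl
    exact (single_mem_compV_iff G a mu).1 (h' ▸ ha)

/-- Every element of the Levi subgroup permutes the subspaces `V_lam`; this is the action of `L`
on the set of coherent components. -/
lemma existsUnique_map_comp {φ : LieAlg G ≃ₗ⁅ℚ⁆ LieAlg G} (hφ : φ ∈ levi G)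
    (lam : Component G) :
    ∃! mu : Component G, (comp G lam).map (φ.toLinearEquiv : LieAlg G →ₗ[ℚ] LieAlg G)
      = comp G mu := by
  obtain ⟨σ, g, hg, h⟩ := hφ
  have key : (comp G lam).map (φ.toLinearEquiv : LieAlg G →ₗ[ℚ] LieAlg G)
      = comp G (componentMap G σ lam) := by
    ext x
    constructor
    · rintro ⟨_, ⟨v, hv, rfl⟩, rfl⟩
      exact ⟨_, permV_mem G σ (hg.mem hv), (h v).symm⟩
    · rintro ⟨w, hw, rfl⟩
      have hw' := permV_mem G σ.symm hw
      rw [componentMap_symm] at hw'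
      refine ⟨_, ⟨g.symm (permV G σ.symm w), hg.symm_mem hw', rfl⟩, ?_⟩
      change φ (inclV G _) = _
      rw [h]
      simp [permV_symm]
  exact ⟨_, key, fun mu hmu => comp_injective G (hmu.symm.trans key)⟩

/-! ### The induced representations and the numbers `c(lam)` -/

variable {G} {H : Type v} [Group H] (ρ : H →* (LieAlg G ≃ₗ⁅ℚ⁆ LieAlg G))

/-- `h · lam = mu`, that is, `ρ(h)(V_lam) = V_mu`. -/
def Moves (h : H) (lam mu : Component G) : Prop :=
  (comp G lam).map ((ρ h).toLinearEquiv : LieAlg G →ₗ[ℚ] LieAlg G) = comp G mu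

/-- The orbit `H · lam`. -/
def orbit (lam : Component G) : Set (Component G) := {mu | ∃ h : H, Moves ρ h lam mu}

open Classical in
/-- `c(lam) = 2` if two vertices in the union of the coherent components in the orbit `H · lam`
are adjacent, and `c(lam) = 1` otherwise. -/
noncomputable def cNumber (lam : Component G) : ℕ :=
  if ∃ a b : S, toComponent G a ∈ orbit ρ lam ∧ toComponent G b ∈ orbit ρ lam ∧ G.Adj a b
  then 2 else 1

/-- The stabilizer `H_lam = {h | ρ(h)(V_lam) = V_lam}`. -/
def stab (lam : Component G) : Subgroup H where
  carrier := {h | Moves ρ h lam lam}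
  one_mem' := by
    change Submodule.map _ _ = _
    rw [map_one]
    exact Submodule.map_id _
  mul_mem' := by
    intro h k hh hk
    change Submodule.map _ _ = _
    rw [map_mul]
    change Submodule.map (((ρ h).toLinearEquiv : LieAlg G →ₗ[ℚ] LieAlg G) ∘ₗ
      ((ρ k).toLinearEquiv : LieAlg G →ₗ[ℚ] LieAlg G)) _ = _
    rw [Submodule.map_comp]
    exact (congrArg _ hk).trans hh
  inv_mem' := by
    intro h hh
    change Submodule.map _ _ = _
    rw [map_inv]
    have hh' : Submodule.map ((ρ h).toLinearEquiv : LieAlg G →ₗ[ℚ] LieAlg G) (comp G lam)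
      = comp G lam := hh
    conv_lhs => rw [← hh']
    rw [← Submodule.map_comp]
    convert Submodule.map_id _
    ext x : 1
    exact (ρ h).symm_apply_apply x

/-- The representation of the stabilizer `H_lam` on `V_lam` obtained by restricting `ρ`. -/
noncomputable def stabRep (lam : Component G) :
    stab ρ lam →* (comp G lam ≃ₗ[ℚ] comp G lam) where
  toFun h := (ρ h).toLinearEquiv.ofSubmodules (comp G lam) (comp G lam) h.2
  map_one' := by
    ext x
    change (ρ 1) x = x
    rw [map_one]
    rfl
  map_mul' h k := by
    ext x
    change (ρ (h * k)) x = _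
    rw [map_mul]
    rfl

end Levi

end GraphLie

/-!
Eigenvalues are handled through left eigenvectors: `μ` is a complex eigenvalue of a rational map `f`
if and only if `l ∘ f = μ l` for some nonzero `ℚ`-linear functional `l` with values in `ℂ`
(`mem_aroots_charpoly_iff_exists_functional`). Moreover, a rational map is integer-like if and
only if all its eigenvalues are units of the ring of algebraic integers (`isIntegerLike_iff`).

Given an Anosov automorphism `φ`, one shows that `φ` permutes the subspaces `⟨b | b ≺ a⟩` of
`V = n_G / [n_G, n_G]` (`GraphLie.exists_perm_map_flag`): for `x` in `V` the rank of `ad x` is at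
least the degree of any vertex occurring in `x`, and this forces a permutation of the vertices along
nonzero matrix entries of `φ` to describe the action on these flags. Some power of `φ`, again Anosov
and commuting with `ρ(H)`, preserves all flags. It induces on `V_lam` a diagonal block whose
eigenvalues are eigenvalues of the power, and which commutes with the stabilizer of `lam`. Blocks in
one orbit are conjugate; if an edge joins two components of the orbit, then the wedge product of
left eigenvectors of the two blocks is a functional on `W` that is a left eigenvector on the brackets
of the two flags (`GraphLie.IsFlagEigenfunctional.mul_mem_aroots`). So products of two
eigenvalues are eigenvalues of the power, hence do not have absolute value `1`; the only exception,
the square of an eigenvalue, is covered by hyperbolicity of the block itself.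

Conversely, maps on the components are chosen at representatives of the orbits and conjugated by
`ρ(H)` to a block-diagonal map on `V` that commutes with `ρ(H)`
(`GraphLie.exists_equivariant_block`). It extends to an automorphism, whose eigenvalues on `W` are
products of eigenvalues at adjacent components (`GraphLie.mem_aroots_of_glued`). Within an orbit
these are off the unit circle by the condition on `c(lam)`; for two different orbits this holds after
passing to powers with sparse exponents, one for each orbit (`exists_sparse_exponents`).
-/

/-! ### Left eigenvectors over the complex numbers -/

section LeftEigenvectors

variable {M : Type*} [AddCommGroup M] [Module ℚ M]

/-- Precomposition with `f`, as a `ℂ`-linear operator on the complex-valued `ℚ`-linear functionals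
on `M`. Its eigenvectors are the left eigenvectors of `f` over `ℂ`, and replace the eigenvectors of
the complexification of `f`. -/
noncomputable def precomp (f : M →ₗ[ℚ] M) : Module.End ℂ (M →ₗ[ℚ] ℂ) where
  toFun l := l ∘ₗ f
  map_add' _ _ := rfl
  map_smul' _ _ := rfl

@[simp] lemma precomp_apply (f : M →ₗ[ℚ] M) (l : M →ₗ[ℚ] ℂ) (x : M) :
    precomp f l x = l (f x) := rfl

lemma precomp_pow (f : M →ₗ[ℚ] M) (n : ℕ) : precomp (f ^ n) = precomp f ^ n := by
  induction n with
  | zero => rfl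
  | succ n ih => rw [pow_succ, pow_succ', ← ih]; rfl

variable [Module.Finite ℚ M]

/-- A functional which is a left eigenvector of `f` on an invariant subspace, without vanishing
there, has an eigenvalue of `f`: the characteristic polynomial of `f` kills the subspace. -/
lemma mem_aroots_charpoly_of_invariant {f : M →ₗ[ℚ] M} {θ : ℂ} (N : Submodule ℚ M)
    (hN : ∀ x ∈ N, f x ∈ N) (l : M →ₗ[ℚ] ℂ) (hl : ∀ x ∈ N, l (f x) = θ * l x)
    {x : M} (hx : x ∈ N) (hlx : l x ≠ 0) : θ ∈ f.charpoly.aroots ℂ := by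
  have key : ∀ q : ℚ[X], l (Polynomial.aeval f q x) = Polynomial.aeval θ q * l x := by
    have mon : ∀ n : ℕ, (f ^ n) x ∈ N ∧ l ((f ^ n) x) = θ ^ n * l x := by
      intro n
      induction n with
      | zero => simpa using hx
      | succ n ih =>
        rw [pow_succ' f]
        refine ⟨hN _ ih.1, ?_⟩
        rw [Module.End.mul_apply, hl _ ih.1, ih.2, pow_succ', mul_assoc]
    intro q
    induction q using Polynomial.induction_on' with
    | add p q hp hq => simp only [map_add, LinearMap.add_apply, hp, hq, add_mul]
    | monomial n a =>
      simp only [Polynomial.aeval_monomial, Module.End.mul_apply, Module.algebraMap_end_apply,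
        map_smul, (mon n).2, mul_assoc, Algebra.smul_def]
  rw [Polynomial.mem_aroots]
  refine ⟨f.charpoly_monic.ne_zero, ?_⟩
  have h := key f.charpoly
  rw [LinearMap.aeval_self_charpoly, LinearMap.zero_apply, map_zero] at h
  exact (mul_eq_zero.1 h.symm).resolve_right hlx

lemma mem_aroots_charpoly_iff_exists_functional {f : M →ₗ[ℚ] M} {θ : ℂ} :
    θ ∈ f.charpoly.aroots ℂ ↔ ∃ l : M →ₗ[ℚ] ℂ, l ≠ 0 ∧ ∀ x, l (f x) = θ * l x := by
  constructor
  · intro h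
    have hroot : (f.baseChange ℂ).charpoly.IsRoot θ := by
      rw [LinearMap.charpoly_baseChange]
      exact Polynomial.isRoot_of_mem_roots h
    have hev := (Module.End.hasEigenvalue_iff_isRoot_charpoly _ _).2 hroot
    have hsp := Module.End.hasEigenvalue_iff_mem_spectrum.1 hev
    rw [spectrum.mem_iff, LinearMap.isUnit_iff_range_eq_top] at hsp
    obtain ⟨l, hl0, hl⟩ := Submodule.exists_le_ker_of_lt_top _ (lt_top_iff_ne_top.2 hsp)
    refine ⟨l.restrictScalars ℚ ∘ₗ TensorProduct.mk ℚ ℂ M 1, fun h0 => hl0 ?_, fun x => ?_⟩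
    · ext x
      exact LinearMap.congr_fun h0 x
    · have := hl ⟨1 ⊗ₜ x, rfl⟩
      simp only [LinearMap.mem_ker, LinearMap.sub_apply, Module.algebraMap_end_apply, map_sub,
        map_smul, LinearMap.baseChange_tmul, sub_eq_zero, smul_eq_mul] at this
      exact this.symm
  · rintro ⟨l, hl0, hl⟩
    obtain ⟨x, hx⟩ : ∃ x, l x ≠ 0 := by
      by_contra! h
      exact hl0 (LinearMap.ext h)
    exact mem_aroots_charpoly_of_invariant ⊤ (fun _ _ => trivial) l (fun x _ => hl x) trivial hx

lemma mem_aroots_charpoly_iff_hasEigenvalue {f : M →ₗ[ℚ] M} {θ : ℂ} :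
    θ ∈ f.charpoly.aroots ℂ ↔ (precomp f).HasEigenvalue θ := by
  rw [mem_aroots_charpoly_iff_exists_functional]
  constructor
  · rintro ⟨l, h0, hl⟩
    exact Module.End.hasEigenvalue_of_hasEigenvector
      ⟨Module.End.mem_eigenspace_iff.2 (LinearMap.ext hl), h0⟩
  · intro h
    obtain ⟨l, hl, h0⟩ := h.exists_hasEigenvector
    exact ⟨l, h0, fun x => LinearMap.congr_fun (Module.End.mem_eigenspace_iff.1 hl) x⟩

lemma exists_pow_eq_of_mem_aroots_charpoly_pow {f : M →ₗ[ℚ] M} {n : ℕ} (hn : 0 < n) {θ : ℂ}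
    (h : θ ∈ (f ^ n).charpoly.aroots ℂ) : ∃ μ ∈ f.charpoly.aroots ℂ, μ ^ n = θ := by
  rw [mem_aroots_charpoly_iff_hasEigenvalue, Module.End.hasEigenvalue_iff_mem_spectrum,
    precomp_pow, spectrum.map_pow_of_pos _ hn] at h
  obtain ⟨μ, hμ, rfl⟩ := h
  exact ⟨μ, mem_aroots_charpoly_iff_hasEigenvalue.2
    (Module.End.hasEigenvalue_iff_mem_spectrum.2 hμ), rfl⟩

lemma ne_zero_of_mem_aroots_charpoly {f : M →ₗ[ℚ] M} (hf : Function.Surjective f) {θ : ℂ}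
    (h : θ ∈ f.charpoly.aroots ℂ) : θ ≠ 0 := by
  rintro rfl
  obtain ⟨l, h0, hl⟩ := mem_aroots_charpoly_iff_exists_functional.1 h
  refine h0 (LinearMap.ext fun x => ?_)
  obtain ⟨y, rfl⟩ := hf x
  simp [hl]

/-- A simultaneous eigenform: if `B (f x) (g y) = θ * B x y` for a nonzero bilinear form `B`, then
`θ` is the product of an eigenvalue of `f` and one of `g`. The space of all such `B` is stable under
`B ↦ B (f ·) ·`; an eigenvector of this operator has left eigenvectors of `f` and `g` as its
partial functionals. -/
lemma exists_mul_eq_of_bilinear {N : Type*} [AddCommGroup N] [Module ℚ N] [Module.Finite ℚ N]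
    {f : M →ₗ[ℚ] M} (hf : Function.Surjective f) {g : N →ₗ[ℚ] N} {θ : ℂ}
    (B : M →ₗ[ℚ] N →ₗ[ℚ] ℂ) (hB : B ≠ 0) (h : ∀ x y, B (f x) (g y) = θ * B x y) :
    ∃ μ ∈ f.charpoly.aroots ℂ, ∃ ν ∈ g.charpoly.aroots ℂ, μ * ν = θ := by
  let E : Submodule ℂ (M →ₗ[ℚ] N →ₗ[ℚ] ℂ) :=
    { carrier := {B | ∀ x y, B (f x) (g y) = θ * B x y}
      add_mem' := fun {a b} ha hb x y => by simp [ha x y, hb x y, mul_add]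
      zero_mem' := fun x y => by simp
      smul_mem' := fun c a ha x y => by simp [ha x y, mul_left_comm] }
  let P : Module.End ℂ E :=
    { toFun := fun B => ⟨B.1 ∘ₗ f, fun x y => B.2 (f x) y⟩
      map_add' := fun _ _ => rfl
      map_smul' := fun _ _ => rfl }
  have : Nontrivial E := ⟨⟨⟨B, h⟩, 0, fun e => hB (congrArg Subtype.val e)⟩⟩
  obtain ⟨μ, hμ⟩ := Module.End.exists_eigenvalue (K := ℂ) (V := E) P
  obtain ⟨⟨C, hC⟩, hCμ, hC0⟩ := hμ.exists_hasEigenvector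
  have hμC : ∀ x y, C (f x) y = μ * C x y := fun x y =>
    LinearMap.congr_fun (LinearMap.congr_fun
      (congrArg Subtype.val (Module.End.mem_eigenspace_iff.1 hCμ)) x) y
  obtain ⟨x, y, hxy⟩ : ∃ x y, C x y ≠ 0 := by
    by_contra! h0
    exact hC0 (Subtype.ext (LinearMap.ext fun x => LinearMap.ext fun y => h0 x y))
  have hμ' : μ ∈ f.charpoly.aroots ℂ := mem_aroots_charpoly_iff_exists_functional.2
    ⟨C.flip y, fun h0 => hxy (LinearMap.congr_fun h0 x), fun x => hμC x y⟩
  have hμ0 := ne_zero_of_mem_aroots_charpoly hf hμ'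
  refine ⟨μ, hμ', θ / μ, mem_aroots_charpoly_iff_exists_functional.2
    ⟨C x, fun h0 => hxy (LinearMap.congr_fun h0 y), fun y => ?_⟩, mul_div_cancel₀ _ hμ0⟩
  have h1 := hC x y
  rw [hμC] at h1
  field_simp
  linear_combination h1

end LeftEigenvectors

/-! ### Integer-like maps and algebraic units -/

section IntegerLike

/-- The units of the ring of algebraic integers, as complex numbers. -/
def IsAlgebraicUnit (μ : ℂ) : Prop := μ ≠ 0 ∧ IsIntegral ℤ μ ∧ IsIntegral ℤ μ⁻¹

lemma IsAlgebraicUnit.mul {μ ν : ℂ} (hμ : IsAlgebraicUnit μ) (hν : IsAlgebraicUnit ν) :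
    IsAlgebraicUnit (μ * ν) :=
  ⟨mul_ne_zero hμ.1 hν.1, hμ.2.1.mul hν.2.1, by rw [mul_inv]; exact hμ.2.2.mul hν.2.2⟩

lemma IsAlgebraicUnit.pow {μ : ℂ} (hμ : IsAlgebraicUnit μ) (n : ℕ) : IsAlgebraicUnit (μ ^ n) :=
  ⟨pow_ne_zero n hμ.1, hμ.2.1.pow n, by rw [← inv_pow]; exact hμ.2.2.pow n⟩

variable {M : Type u} [AddCommGroup M] [Module ℚ M] [Module.Finite ℚ M]

lemma isIntegral_coeff_of_isIntegral_roots {p : ℚ[X]} (hp : p.Monic)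
    (h : ∀ μ ∈ p.aroots ℂ, IsIntegral ℤ μ) (n : ℕ) : IsIntegral ℤ (p.coeff n) := by
  have hs : p.map (algebraMap ℚ ℂ)
      = ((p.aroots ℂ).map fun a => Polynomial.X - Polynomial.C a).prod :=
    (IsAlgClosed.splits _).eq_prod_roots_of_monic (hp.map _)
  have h1 : p.map (algebraMap ℚ ℂ) ∈ Polynomial.lifts (algebraMap (integralClosure ℤ ℂ) ℂ) := by
    rw [hs]
    refine Subsemiring.multiset_prod_mem _ _ fun q hq => ?_
    obtain ⟨a, ha, rfl⟩ := Multiset.mem_map.1 hq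
    rw [sub_eq_add_neg, ← Polynomial.C_neg]
    exact add_mem (Polynomial.X_mem_lifts _)
      (Polynomial.C_mem_lifts (algebraMap (integralClosure ℤ ℂ) ℂ) ⟨-a, (h a ha).neg⟩)
  obtain ⟨x, hx⟩ := (Polynomial.lifts_iff_coeff_lifts _).1 h1 n
  rw [Polynomial.coeff_map] at hx
  refine (isIntegral_algebraMap_iff (algebraMap ℚ ℂ).injective).1 ?_
  rw [← hx]
  exact x.2

/-- A rational map is integer-like if and only if its complex eigenvalues are units of the ring of
algebraic integers. -/
lemma isIntegerLike_iff {f : M →ₗ[ℚ] M} :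
    IsIntegerLike f ↔ ∀ μ ∈ f.charpoly.aroots ℂ, IsAlgebraicUnit μ := by
  constructor
  · rintro ⟨q, hq, hq0⟩ μ hμ
    have hqm : q.Monic := by
      refine Polynomial.monic_of_injective (Int.castRingHom ℚ).injective_int ?_
      rw [hq]
      exact f.charpoly_monic
    have hroot : Polynomial.aeval μ q = 0 := by
      have h := (Polynomial.mem_aroots.1 hμ).2
      rw [← hq] at h
      rwa [← Polynomial.aeval_map_algebraMap ℚ]
    have hint : IsIntegral ℤ μ := ⟨q, hqm, hroot⟩
    have hprod : μ * Polynomial.aeval μ q.divX = - (q.coeff 0 : ℂ) := by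
      have h := hroot
      rw [← q.divX_mul_X_add, map_add, map_mul, Polynomial.aeval_X, Polynomial.aeval_C] at h
      simp only [algebraMap_int_eq, eq_intCast] at h
      linear_combination h
    have hdiv : IsIntegral ℤ (Polynomial.aeval μ q.divX) := by
      have h : (⟨μ, hint⟩ : integralClosure ℤ ℂ).1 = μ := rfl
      rw [← h, Subalgebra.aeval_coe]
      exact (Polynomial.aeval (⟨μ, hint⟩ : integralClosure ℤ ℂ) q.divX).2
    have hμ0 : μ ≠ 0 := by
      rintro rfl
      rcases hq0 with h | h <;> simp [h] at hprod
    refine ⟨hμ0, hint, ?_⟩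
    -- `q = X * q.divX + q.coeff 0` exhibits the inverse of `μ` as a polynomial in `μ`
    have : μ⁻¹ = - (q.coeff 0 : ℂ) * Polynomial.aeval μ q.divX := by
      refine inv_eq_of_mul_eq_one_right ?_
      rw [mul_left_comm, hprod]
      rcases hq0 with h | h <;> simp [h]
    rw [this]
    refine IsIntegral.mul (IsIntegral.neg ?_) hdiv
    exact isIntegral_algebraMap (R := ℤ) (x := q.coeff 0)
  · intro h
    have hcoeff := isIntegral_coeff_of_isIntegral_roots f.charpoly_monic fun μ hμ => (h μ hμ).2.1
    obtain ⟨q, hq⟩ : ∃ q : ℤ[X], q.map (Int.castRingHom ℚ) = f.charpoly :=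
      (Polynomial.lifts_iff_coeff_lifts _).2 fun n => IsIntegrallyClosed.isIntegral_iff.1 (hcoeff n)
    refine ⟨q, hq, ?_⟩
    have hs : f.charpoly.map (algebraMap ℚ ℂ)
        = ((f.charpoly.aroots ℂ).map fun a => Polynomial.X - Polynomial.C a).prod :=
      (IsAlgClosed.splits _).eq_prod_roots_of_monic (f.charpoly_monic.map _)
    have hc0 : (q.coeff 0 : ℂ) = ((f.charpoly.aroots ℂ).map fun a => -a).prod := by
      have h1 := congrArg (Polynomial.eval 0) hs
      rw [Polynomial.eval_multiset_prod, Multiset.map_map, ← hq, Polynomial.map_map,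
        ← Polynomial.coeff_zero_eq_eval_zero, Polynomial.coeff_map] at h1
      simpa [hq] using h1
    -- the constant term is, up to sign, the product of the eigenvalues, so it is a unit
    have hunit : q.coeff 0 ≠ 0 ∧ IsIntegral ℤ ((q.coeff 0 : ℚ)⁻¹) := by
      have : ∀ s : Multiset ℂ, (∀ μ ∈ s, IsAlgebraicUnit μ) →
          IsAlgebraicUnit (s.map fun a => -a).prod := by
        intro s
        induction s using Multiset.induction_on with
        | empty => intro _; simp [IsAlgebraicUnit, isIntegral_one]
        | cons a s ih =>
          intro hs
          rw [Multiset.map_cons, Multiset.prod_cons]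
          have ha := hs a (Multiset.mem_cons_self _ _)
          refine IsAlgebraicUnit.mul ⟨neg_ne_zero.2 ha.1, ha.2.1.neg, ?_⟩
            (ih fun μ hμ => hs μ (Multiset.mem_cons_of_mem hμ))
          rw [inv_neg]
          exact ha.2.2.neg
      have h2 := this _ h
      rw [← hc0] at h2
      refine ⟨fun e => h2.1 (by simp [e]), ?_⟩
      refine (isIntegral_algebraMap_iff (algebraMap ℚ ℂ).injective).1 ?_
      simpa using h2.2.2
    obtain ⟨m, hm⟩ := IsIntegrallyClosed.isIntegral_iff.1 hunit.2
    have hne : (q.coeff 0 : ℚ) ≠ 0 := by exact_mod_cast hunit.1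
    have hmul : q.coeff 0 * m = 1 := by
      have : (q.coeff 0 : ℚ) * m = 1 := by
        rw [show (m : ℚ) = (q.coeff 0 : ℚ)⁻¹ from hm]
        exact mul_inv_cancel₀ hne
      exact_mod_cast this
    exact Int.isUnit_iff.1 (IsUnit.of_mul_eq_one _ hmul)

end IntegerLike

/-! ### Hyperbolicity and sparse exponents -/

section Hyperbolic

variable {M : Type u} [AddCommGroup M] [Module ℚ M] [Module.Finite ℚ M]

lemma isHyperbolicOfClass_one_iff {f : M →ₗ[ℚ] M} :
    IsHyperbolicOfClass 1 f ↔ ∀ μ ∈ f.charpoly.aroots ℂ, ‖μ‖ ≠ 1 := by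
  constructor
  · intro h μ hμ
    simpa using h 1 le_rfl le_rfl (fun _ => μ) fun _ => hμ
  · intro h l h1 h2 μ hμ
    obtain rfl : l = 1 := le_antisymm h2 h1
    simpa using h _ (hμ 0)

lemma isHyperbolicOfClass_two_iff {f : M →ₗ[ℚ] M} :
    IsHyperbolicOfClass 2 f ↔ (∀ μ ∈ f.charpoly.aroots ℂ, ‖μ‖ ≠ 1) ∧
      ∀ μ ∈ f.charpoly.aroots ℂ, ∀ ν ∈ f.charpoly.aroots ℂ, ‖μ‖ * ‖ν‖ ≠ 1 := by
  constructor
  · intro h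
    refine ⟨fun μ hμ => ?_, fun μ hμ ν hν => ?_⟩
    · simpa using h 1 le_rfl one_le_two (fun _ => μ) fun _ => hμ
    · have := h 2 one_le_two le_rfl ![μ, ν] fun j => by fin_cases j <;> assumption
      simpa [Fin.prod_univ_two] using this
  · rintro ⟨ha, hb⟩ l h1 h2 μ hμ
    obtain rfl | rfl : l = 1 ∨ l = 2 := by omega
    · simpa using ha _ (hμ 0)
    · simpa [Fin.prod_univ_two] using hb _ (hμ 0) _ (hμ 1)

lemma isAnosov_iff {L : Type u} [LieRing L] [LieAlgebra ℚ L] [Module.Finite ℚ L]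
    {φ : L ≃ₗ⁅ℚ⁆ L} : IsAnosov φ ↔
      ∀ μ ∈ (φ.toLinearEquiv : L →ₗ[ℚ] L).charpoly.aroots ℂ, ‖μ‖ ≠ 1 ∧ IsAlgebraicUnit μ := by
  rw [IsAnosov, isIntegerLike_iff]
  exact ⟨fun h μ hμ => ⟨h.1 μ hμ, h.2 μ hμ⟩,
    fun h => ⟨fun μ hμ => (h μ hμ).1, fun μ hμ => (h μ hμ).2⟩⟩

/-- Exponents that are sufficiently sparse prevent cancellation between two different powers of
numbers off the unit circle. -/
lemma exists_sparse_exponents {X : Set ℂ} (hX : X.Finite) (h : ∀ α ∈ X, α ≠ 0 ∧ ‖α‖ ≠ 1) :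
    ∃ N : ℕ, 0 < N ∧ ∀ α ∈ X, ∀ β ∈ X, ∀ i j : ℕ, i ≠ j →
      ‖α‖ ^ N ^ i * ‖β‖ ^ N ^ j ≠ 1 := by
  obtain ⟨C, hC⟩ := ((hX.prod hX).image
    fun p : ℂ × ℂ => |Real.log ‖p.1‖| / |Real.log ‖p.2‖|).bddAbove
  obtain ⟨N, hN⟩ := exists_nat_gt (max C 0)
  have hlog : ∀ α ∈ X, 0 < |Real.log ‖α‖| := fun α hα => by
    have h1 : 0 < ‖α‖ := norm_pos_iff.2 (h α hα).1
    refine abs_pos.2 fun h0 => ?_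
    rcases Real.log_eq_zero.1 h0 with h2 | h2 | h2
    · exact h1.ne' h2
    · exact (h α hα).2 h2
    · linarith
  have hN0 : 0 < N := by
    have := (le_max_right C 0).trans_lt hN
    exact_mod_cast this
  have hlt : ∀ α ∈ X, ∀ β ∈ X, |Real.log ‖α‖| < N * |Real.log ‖β‖| := fun α hα β hβ => by
    rw [← div_lt_iff₀ (hlog β hβ)]
    exact (hC ⟨(α, β), ⟨hα, hβ⟩, rfl⟩).trans_lt ((le_max_left C 0).trans_lt hN)
  -- a cancellation with `i < j` would give `|log ‖α‖| = N ^ (j - i) * |log ‖β‖|`, although `N`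
  -- exceeds all ratios of such logarithms
  have main : ∀ α ∈ X, ∀ β ∈ X, ∀ i j : ℕ, i < j → ‖α‖ ^ N ^ i * ‖β‖ ^ N ^ j ≠ 1 := by
    intro α hα β hβ i j hij he
    have h1 : 0 < ‖α‖ := norm_pos_iff.2 (h α hα).1
    have h2 : 0 < ‖β‖ := norm_pos_iff.2 (h β hβ).1
    have h3 := congrArg Real.log he
    rw [Real.log_mul (by positivity) (by positivity), Real.log_pow, Real.log_pow, Real.log_one,
      add_eq_zero_iff_eq_neg] at h3
    have h4 := congrArg abs h3
    rw [abs_neg, abs_mul, abs_mul, Nat.abs_cast, Nat.abs_cast] at h4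
    obtain ⟨d, rfl⟩ : ∃ d, j = i + 1 + d := ⟨j - (i + 1), by omega⟩
    have h5 : |Real.log ‖α‖| = N ^ d * (N * |Real.log ‖β‖|) := by
      have hpos : (0 : ℝ) < (N : ℝ) ^ i := by positivity
      refine mul_left_cancel₀ hpos.ne' ?_
      push_cast at h4
      rw [h4]
      ring
    have h6 : (1 : ℝ) ≤ (N : ℝ) ^ d := one_le_pow₀ (by exact_mod_cast hN0)
    have h7 := hlt α hα β hβ
    nlinarith [(hlog α hα).trans h7]
  refine ⟨N, hN0, fun α hα β hβ i j hij => ?_⟩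
  rcases lt_or_gt_of_ne hij with hij | hij
  · exact main α hα β hβ i j hij
  · rw [mul_comm]
    exact main β hβ α hα j i hij

end Hyperbolic

namespace GraphLie

/-! ### The bracket and the maps induced on `V` and `W` -/

section Graded

variable {S : Type u} [Fintype S] [DecidableEq S] {G : SimpleGraph S}

lemma eq_sum_smul_single (v : S → ℚ) : v = ∑ a, v a • (Pi.single a 1 : S → ℚ) := by
  ext i
  simp [Finset.sum_apply, Pi.single_apply]

/-- The universal property of `W`: an alternating bilinear map on `V` factors through the bracket
if it vanishes on the pairs of vertices that are not adjacent. -/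
lemma exists_factor_bracketV {M : Type*} [AddCommGroup M] [Module ℚ M]
    (B : (S → ℚ) →ₗ[ℚ] (S → ℚ) →ₗ[ℚ] M) (hB : ∀ x, B x x = 0)
    (hadj : ∀ a b, ¬ G.Adj a b → B (Pi.single a 1) (Pi.single b 1) = 0) :
    ∃ k : W G →ₗ[ℚ] M, ∀ x y, k (bracketV G x y) = B x y := by
  let A : (S → ℚ) [⋀^Fin 2]→ₗ[ℚ] M :=
    { toFun := fun v => B (v 0) (v 1)
      map_update_add' := fun v i x y => by fin_cases i <;> simp
      map_update_smul' := fun v i c x => by fin_cases i <;> simp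
      map_eq_zero_of_eq' := fun v i j h hij => by
        have : v 0 = v 1 := by
          fin_cases i <;> fin_cases j
          · exact absurd rfl hij
          · exact h
          · exact h.symm
          · exact absurd rfl hij
        change B (v 0) (v 1) = 0
        rw [this, hB] }
  let k : W G →ₗ[ℚ] M :=
    (exteriorPower.alternatingMapLinearEquiv A) ∘ₗ (edgeSpace G).subtype
  have hk : ∀ a b, k (basisBracket G a b) = B (Pi.single a 1) (Pi.single b 1) := by
    intro a b
    unfold basisBracket
    split_ifs with h
    · exact exteriorPower.alternatingMapLinearEquiv_apply_ιMulti A _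
    · rw [map_zero, hadj a b h]
  refine ⟨k, fun x y => ?_⟩
  conv_rhs => rw [eq_sum_smul_single x, eq_sum_smul_single y]
  simp only [bracketV, map_sum, map_smul, hk, LinearMap.sum_apply, LinearMap.smul_apply,
    Finset.smul_sum, smul_smul]
  rw [Finset.sum_comm]
  simp only [mul_comm]

lemma mem_span_bracketV (w : W G) :
    w ∈ Submodule.span ℚ (Set.range fun p : (S → ℚ) × (S → ℚ) => bracketV G p.1 p.2) := by
  obtain ⟨w, hw⟩ := w
  induction hw using Submodule.span_induction with
  | mem x h =>
    obtain ⟨a, b, hab, rfl⟩ := h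
    refine Submodule.subset_span ⟨(Pi.single a 1, Pi.single b 1), ?_⟩
    change bracketV G (Pi.single a 1) (Pi.single b 1) = _
    rw [bracketV_single, basisBracket, dif_pos hab]
    rfl
  | zero => exact Submodule.zero_mem _
  | add x y hx hy ihx ihy => exact Submodule.add_mem _ ihx ihy
  | smul c x hx ih => exact Submodule.smul_mem _ c ih

lemma hom_ext_W {M : Type*} [AddCommGroup M] [Module ℚ M] {k l : W G →ₗ[ℚ] M}
    (h : ∀ x y, k (bracketV G x y) = l (bracketV G x y)) : k = l := by
  refine LinearMap.ext fun w => ?_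
  have := mem_span_bracketV w
  induction this using Submodule.span_induction with
  | mem x hx => obtain ⟨p, rfl⟩ := hx; exact h _ _
  | zero => simp
  | add x y _ _ hx hy => rw [map_add, map_add, hx, hy]
  | smul c x _ hx => rw [map_smul, map_smul, hx]

variable (G) in
/-- The bracket `V × V → W`, as a bilinear map. -/
noncomputable def bracketHom : (S → ℚ) →ₗ[ℚ] (S → ℚ) →ₗ[ℚ] W G :=
  LinearMap.mk₂ ℚ (bracketV G) (bracketV_add_left G)
    (fun c x y => by rw [bracketV_swap, bracketV_smul_right, ← smul_neg, ← bracketV_swap])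
    (bracketV_add_right G) (bracketV_smul_right G)

@[simp] lemma bracketHom_apply (x y : S → ℚ) : bracketHom G x y = bracketV G x y := rfl

variable (G) in
/-- The projection of `n_G = V ⊕ W` onto `W`. -/
noncomputable def projW : LieAlg G →ₗ[ℚ] W G := LinearMap.snd ℚ (S → ℚ) (W G)

@[simp] lemma projW_inclV (v : S → ℚ) : projW G (inclV G v) = 0 := rfl
@[simp] lemma projW_inclW (w : W G) : projW G (inclW G w) = w := rfl

lemma inclV_projV_add (x : LieAlg G) : inclV G (projV G x) + inclW G (projW G x) = x := by
  apply Prod.ext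
  · exact add_zero x.1
  · exact zero_add x.2

/-- The map on `V = n_G / [n_G, n_G]` induced by an automorphism. -/
noncomputable def vPart (φ : LieAlg G ≃ₗ⁅ℚ⁆ LieAlg G) : (S → ℚ) →ₗ[ℚ] (S → ℚ) :=
  projV G ∘ₗ (φ.toLinearEquiv : LieAlg G →ₗ[ℚ] LieAlg G) ∘ₗ inclV G

/-- The restriction of an automorphism to `W`. -/
noncomputable def wPart (φ : LieAlg G ≃ₗ⁅ℚ⁆ LieAlg G) : W G →ₗ[ℚ] W G :=
  projW G ∘ₗ (φ.toLinearEquiv : LieAlg G →ₗ[ℚ] LieAlg G) ∘ₗ inclW G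

lemma map_inclW_bracketV (φ : LieAlg G ≃ₗ⁅ℚ⁆ LieAlg G) (x y : S → ℚ) :
    φ (inclW G (bracketV G x y)) = inclW G (bracketV G (vPart φ x) (vPart φ y)) := by
  have h : inclW G (bracketV G x y) = ⁅inclV G x, inclV G y⁆ := rfl
  rw [h, LieEquiv.map_lie]
  rfl

lemma wPart_bracketV (φ : LieAlg G ≃ₗ⁅ℚ⁆ LieAlg G) (x y : S → ℚ) :
    wPart φ (bracketV G x y) = bracketV G (vPart φ x) (vPart φ y) :=
  congrArg (projW G) (map_inclW_bracketV φ x y)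

lemma map_inclW (φ : LieAlg G ≃ₗ⁅ℚ⁆ LieAlg G) (w : W G) :
    φ (inclW G w) = inclW G (wPart φ w) := by
  refine LinearMap.congr_fun (hom_ext_W
    (k := (φ.toLinearEquiv : LieAlg G →ₗ[ℚ] LieAlg G) ∘ₗ inclW G)
    (l := inclW G ∘ₗ wPart φ) fun x y => ?_) w
  change φ (inclW G (bracketV G x y)) = inclW G (wPart φ (bracketV G x y))
  rw [wPart_bracketV, map_inclW_bracketV]

lemma projV_map (φ : LieAlg G ≃ₗ⁅ℚ⁆ LieAlg G) (x : LieAlg G) :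
    projV G (φ x) = vPart φ (projV G x) := by
  conv_lhs => rw [← inclV_projV_add x, map_add, map_inclW, map_add, projV_inclW, add_zero]
  rfl

lemma vPart_mul (φ ψ : LieAlg G ≃ₗ⁅ℚ⁆ LieAlg G) : vPart (φ * ψ) = vPart φ * vPart ψ :=
  LinearMap.ext fun x => projV_map φ (ψ (inclV G x))

lemma vPart_pow (φ : LieAlg G ≃ₗ⁅ℚ⁆ LieAlg G) (n : ℕ) : vPart (φ ^ n) = vPart φ ^ n := by
  induction n with
  | zero => rfl
  | succ n ih => rw [pow_succ, pow_succ, vPart_mul, ih]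

lemma toLinear_pow (φ : LieAlg G ≃ₗ⁅ℚ⁆ LieAlg G) (n : ℕ) :
    ((φ ^ n).toLinearEquiv : LieAlg G →ₗ[ℚ] LieAlg G)
      = (φ.toLinearEquiv : LieAlg G →ₗ[ℚ] LieAlg G) ^ n := by
  induction n with
  | zero => rfl
  | succ n ih => rw [pow_succ, pow_succ, ← ih]; rfl

lemma isUnit_vPart (φ : LieAlg G ≃ₗ⁅ℚ⁆ LieAlg G) : IsUnit (vPart φ) :=
  ⟨⟨vPart φ, vPart φ⁻¹, by rw [← vPart_mul, mul_inv_cancel]; rfl,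
    by rw [← vPart_mul, inv_mul_cancel]; rfl⟩, rfl⟩

lemma vPart_surjective (φ : LieAlg G ≃ₗ⁅ℚ⁆ LieAlg G) : Function.Surjective (vPart φ) :=
  ((Module.End.isUnit_iff _).1 (isUnit_vPart φ)).2

end Graded

/-! ### Automorphisms permute the flags of vertices -/

section Flag

variable {S : Type u} [Fintype S] [DecidableEq S] {G : SimpleGraph S}

/-- For each vertex `b`, the coordinates on `W` of the edges at `b`. -/
lemma exists_coord (b : S) : ∃ κ : W G →ₗ[ℚ] (G.neighborSet b → ℚ),
    ∀ x y c, κ (bracketV G x y) c = x b * y c - x c * y b := by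
  obtain ⟨k, hk⟩ := exists_factor_bracketV (G := G) (M := G.neighborSet b → ℚ)
    (LinearMap.mk₂ ℚ (fun x y c => x b * y c - x c * y b)
      (fun x y z => by ext; simp; ring) (fun c x y => by ext; simp; ring)
      (fun x y z => by ext; simp; ring) (fun c x y => by ext; simp; ring))
    (fun x => by ext; simp [mul_comm])
    (fun a d had => by
      ext ⟨c, hc⟩
      have hc' : G.Adj b c := hc
      have h1 : ¬ (b = a ∧ c = d) := fun h => had (h.1 ▸ h.2 ▸ hc')
      have h2 : ¬ (c = a ∧ b = d) := fun h => had (h.1 ▸ h.2 ▸ hc'.symm)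
      simp only [LinearMap.mk₂_apply, Pi.single_apply, Pi.zero_apply, ite_mul, one_mul, zero_mul,
        ← ite_and, h1, h2, if_false, sub_zero])
  exact ⟨k, fun x y c => by rw [hk]; rfl⟩

lemma bracketV_single_left (a : S) (y : S → ℚ) :
    bracketV G (Pi.single a 1) y = ∑ b, y b • basisBracket G a b := by
  unfold bracketV
  rw [Finset.sum_eq_single a]
  · simp
  · intro a' _ h; simp [h]
  · simp

lemma apply_eq_zero_of_bracketV_single {a : S} {y : S → ℚ}
    (h : bracketV G (Pi.single a 1) y = 0) {b : S} (hab : G.Adj a b) : y b = 0 := by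
  obtain ⟨κ, hκ⟩ := exists_coord (G := G) a
  have := hκ (Pi.single a 1) y ⟨b, hab⟩
  rw [h, map_zero] at this
  simpa [hab.ne'] using this.symm

lemma finrank_range_bracketHom_single_le (a : S) :
    Module.finrank ℚ (bracketHom G (Pi.single a 1)).range ≤ Nat.card (G.neighborSet a) := by
  classical
  obtain ⟨κ, hκ⟩ := exists_coord (G := G) a
  have hinj : Function.Injective (κ ∘ₗ (bracketHom G (Pi.single a 1)).range.subtype) := by
    rw [injective_iff_map_eq_zero]
    rintro ⟨_, y, rfl⟩ h
    refine Subtype.ext ?_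
    change bracketV G (Pi.single a 1) y = 0
    rw [bracketV_single_left]
    refine Finset.sum_eq_zero fun b _ => ?_
    by_cases hab : G.Adj a b
    · have := hκ (Pi.single a 1) y ⟨b, hab⟩
      rw [show κ (bracketV G (Pi.single a 1) y) = 0 from h] at this
      simp only [Pi.zero_apply, Pi.single_eq_same, one_mul, Pi.single_eq_of_ne hab.ne', zero_mul,
        sub_zero] at this
      rw [← this, zero_smul]
    · rw [basisBracket, dif_neg hab, smul_zero]
  have := LinearMap.finrank_le_finrank_of_injective hinj
  rwa [Module.finrank_fintype_fun_eq_card, ← Nat.card_eq_fintype_card] at this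

/-- If `b` occurs in `x`, then the brackets `[x, c]` with `c` adjacent to `b` are linearly
independent, as their coordinates at the edges at `b` show. -/
lemma exists_surjective_coord {x : S → ℚ} {b : S} (hx : x b ≠ 0) :
    ∃ κ : W G →ₗ[ℚ] (G.neighborSet b → ℚ),
      (∀ x y c, κ (bracketV G x y) c = x b * y c - x c * y b) ∧
      Function.Surjective (κ ∘ₗ (bracketHom G x).range.subtype) := by
  classical
  obtain ⟨κ, hκ⟩ := exists_coord (G := G) b
  refine ⟨κ, hκ, fun g => ?_⟩
  let y : S → ℚ := fun c => if h : G.Adj b c then g ⟨c, h⟩ / x b else 0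
  refine ⟨⟨_, y, rfl⟩, ?_⟩
  change κ (bracketV G x y) = g
  ext ⟨c, hc⟩
  have hc' : G.Adj b c := hc
  rw [hκ]
  simp only [y, dif_pos hc', G.irrefl, dif_neg, not_false_eq_true, mul_zero, sub_zero]
  exact mul_div_cancel₀ _ hx

lemma card_neighborSet_le_finrank {x : S → ℚ} {b : S} (hx : x b ≠ 0) :
    Nat.card (G.neighborSet b) ≤ Module.finrank ℚ (bracketHom G x).range := by
  classical
  obtain ⟨κ, -, hs⟩ := exists_surjective_coord (G := G) hx
  have := LinearMap.finrank_le_finrank_of_surjective hs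
  rwa [Module.finrank_fintype_fun_eq_card, ← Nat.card_eq_fintype_card] at this

lemma range_bracketHom_vPart (φ : LieAlg G ≃ₗ⁅ℚ⁆ LieAlg G) (x : S → ℚ) :
    (bracketHom G (vPart φ x)).range = (bracketHom G x).range.map (wPart φ) := by
  ext w
  constructor
  · rintro ⟨y, rfl⟩
    obtain ⟨y, rfl⟩ := vPart_surjective φ y
    exact ⟨_, ⟨y, rfl⟩, wPart_bracketV φ x y⟩
  · rintro ⟨_, ⟨y, rfl⟩, rfl⟩
    exact ⟨vPart φ y, (wPart_bracketV φ x y).symm⟩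

lemma exists_perm_apply_ne_zero (φ : LieAlg G ≃ₗ⁅ℚ⁆ LieAlg G) :
    ∃ τ : Equiv.Perm S, ∀ a, vPart φ (Pi.single a 1) (τ a) ≠ 0 := by
  have hdet : (LinearMap.toMatrix' (vPart φ)).det ≠ 0 := by
    rw [LinearMap.det_toMatrix']
    exact ((LinearMap.isUnit_iff_isUnit_det _).1 (isUnit_vPart φ)).ne_zero
  rw [Matrix.det_apply] at hdet
  obtain ⟨τ, -, hτ⟩ := Finset.exists_ne_zero_of_sum_ne_zero hdet
  refine ⟨τ, fun a h => hτ ?_⟩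
  rw [Finset.prod_eq_zero (Finset.mem_univ a), smul_zero]
  rwa [LinearMap.toMatrix'_apply]

variable (G) in
/-- The subspace spanned by the vertices `b ≺ a`. -/
def flag (a : S) : Submodule ℚ (S → ℚ) where
  carrier := {v | ∀ b, v b ≠ 0 → Prec G b a}
  add_mem' := fun {v w} hv hw b hb => by
    by_cases h : v b = 0
    · exact hw b fun h' => hb (by simp [h, h'])
    · exact hv b h
  zero_mem' := fun b hb => absurd rfl hb
  smul_mem' := fun c v hv b hb => hv b (right_ne_zero_of_mul hb)

/-- Elements of the flag `⟨b | b ≺ a⟩` bracket the centralizer of `a` in `V` into `[a, V]`. -/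
lemma bracketV_mem_range_of_mem_flag {a : S} {y z : S → ℚ} (hy : y ∈ flag G a)
    (hz : bracketV G (Pi.single a 1) z = 0) :
    bracketV G y z ∈ (bracketHom G (Pi.single a 1)).range := by
  refine Submodule.sum_mem _ fun b _ => Submodule.sum_mem _ fun c _ => ?_
  by_cases hb : y b = 0
  · simp [hb]
  by_cases hc : z c = 0
  · simp [hc]
  refine Submodule.smul_mem _ _ ?_
  by_cases hbc : G.Adj b c
  · rcases hy b hb hbc with rfl | hac
    · rw [basisBracket_swap, ← bracketV_single]
      exact Submodule.neg_mem _ ⟨_, rfl⟩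
    · exact absurd (apply_eq_zero_of_bracketV_single hz hac) hc
  · rw [basisBracket, dif_neg hbc]
    exact Submodule.zero_mem _

/-- Every automorphism permutes the flags `⟨b | b ≺ a⟩`. If the vertex `b` occurs in
`x = φ a`, then the rank of `ad x` on `V` is at least the degree of `b`. So a permutation `τ` along
nonzero matrix entries preserves degrees, and the edges at `τ a` are coordinates on `[φ a, V]`.
These coordinates detect that the elements that bracket the centralizer of `φ a` into `[φ a, V]`
lie in the flag of `τ a`. -/
lemma exists_perm_map_flag (φ : LieAlg G ≃ₗ⁅ℚ⁆ LieAlg G) :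
    ∃ τ : Equiv.Perm S, ∀ a, ∀ y ∈ flag G a, vPart φ y ∈ flag G (τ a) := by
  obtain ⟨τ, hτ⟩ := exists_perm_apply_ne_zero φ
  have hle1 : ∀ a, Module.finrank ℚ (bracketHom G (vPart φ (Pi.single a 1))).range
      ≤ Nat.card (G.neighborSet a) := fun a => by
    rw [range_bracketHom_vPart]
    exact (Submodule.finrank_map_le _ _).trans (finrank_range_bracketHom_single_le a)
  have hle2 := fun a => (card_neighborSet_le_finrank (G := G) (hτ a)).trans (hle1 a)
  have heq : ∀ a, Nat.card (G.neighborSet (τ a)) = Nat.card (G.neighborSet a) := by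
    have := (Finset.sum_eq_sum_iff_of_le fun a (_ : a ∈ Finset.univ) => hle2 a).1
      (Equiv.sum_comp τ fun a => Nat.card (G.neighborSet a))
    exact fun a => this a (Finset.mem_univ a)
  refine ⟨τ, fun a y hy => ?_⟩
  obtain ⟨κ, hκ, hs⟩ := exists_surjective_coord (G := G) (hτ a)
  set x := vPart φ (Pi.single a 1) with hx
  have hinj : Function.Injective (κ ∘ₗ (bracketHom G x).range.subtype) := by
    classical
    refine (LinearMap.injective_iff_surjective_of_finrank_eq_finrank ?_).2 hs
    rw [Module.finrank_fintype_fun_eq_card, ← Nat.card_eq_fintype_card]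
    exact le_antisymm ((hle1 a).trans (heq a).ge) (card_neighborSet_le_finrank (hτ a))
  -- elements of `[φ a, V]` are determined by their coordinates at the edges at `τ a`
  have hzero : ∀ w ∈ (bracketHom G x).range, κ w = 0 → w = 0 := fun w hw h =>
    congrArg Subtype.val (@hinj ⟨w, hw⟩ 0 (h.trans (map_zero _).symm))
  intro e he c hec
  by_contra hc
  have hcb : c ≠ τ a := fun h => hc (Or.inl h)
  have hbc : ¬ G.Adj (τ a) c := fun h => hc (Or.inr h)
  have hκc : ∀ z, κ (bracketV G z (Pi.single c 1)) = 0 := by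
    intro z
    ext ⟨d, hd⟩
    have hdc : d ≠ c := fun h => hbc (h ▸ hd)
    rw [hκ]
    simp [hdc, hcb.symm]
  -- a vertex `c` outside the closed neighbourhood of `τ a` centralizes `φ a`
  have hxc : bracketV G x (Pi.single c 1) = 0 := hzero _ ⟨_, rfl⟩ (hκc x)
  obtain ⟨z, hz⟩ := vPart_surjective φ (Pi.single c 1)
  have haz : bracketV G (Pi.single a 1) z = 0 := by
    have hw : wPart φ⁻¹ (bracketV G x (Pi.single c 1)) = bracketV G (Pi.single a 1) z := by
      have hinv : ∀ v, vPart φ⁻¹ (vPart φ v) = v := fun v => by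
        rw [← Module.End.mul_apply, ← vPart_mul, inv_mul_cancel]
        rfl
      rw [wPart_bracketV, hx, ← hz, hinv, hinv]
    rw [← hw, hxc, map_zero]
  have hmem : bracketV G (vPart φ y) (Pi.single c 1) ∈ (bracketHom G x).range := by
    rw [← hz, ← wPart_bracketV, hx, range_bracketHom_vPart]
    exact ⟨_, bracketV_mem_range_of_mem_flag hy haz, rfl⟩
  have h0 := hzero _ hmem (hκc _)
  rw [bracketV_swap, neg_eq_zero] at h0
  exact he (apply_eq_zero_of_bracketV_single h0 (SimpleGraph.Adj.symm hec))

lemma exists_pow_map_flag (φ : LieAlg G ≃ₗ⁅ℚ⁆ LieAlg G) :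
    ∃ m, 0 < m ∧ ∀ a, ∀ y ∈ flag G a, vPart (φ ^ m) y ∈ flag G a := by
  obtain ⟨τ, hτ⟩ := exists_perm_map_flag φ
  refine ⟨orderOf τ, orderOf_pos τ, fun a y hy => ?_⟩
  have h : ∀ n : ℕ, (vPart φ ^ n) y ∈ flag G ((τ ^ n) a) := by
    intro n
    induction n with
    | zero => exact hy
    | succ n ih => rw [pow_succ', pow_succ']; exact hτ _ _ ih
  have := h (orderOf τ)
  rwa [pow_orderOf_eq_one, ← vPart_pow] at this

end Flag

/-! ### Projections onto the coherent components -/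

section Projections

variable {S : Type u} [Fintype S] [DecidableEq S] {G : SimpleGraph S}

lemma toComponent_eq_iff {a b : S} :
    toComponent G a = toComponent G b ↔ Prec G a b ∧ Prec G b a :=
  Quotient.eq (r := coherent G)

lemma exists_toComponent_eq (lam : Component G) : ∃ a, toComponent G a = lam :=
  Quotient.exists_rep lam

lemma adj_of_toComponent_eq {a b c d : S} (hab : G.Adj a b)
    (hc : toComponent G c = toComponent G a) (hd : toComponent G d = toComponent G b)
    (hcd : c ≠ d) : G.Adj c d := by
  have hac := (toComponent_eq_iff.1 hc).2
  have hbd := (toComponent_eq_iff.1 hd).2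
  rcases hac hab with rfl | hcb
  · rcases hbd hab.symm with rfl | hda
    · exact hab.symm
    · rcases hac (SimpleGraph.Adj.symm hda) with h | h
      · exact absurd h.symm hcd
      · exact h
  · rcases hbd (SimpleGraph.Adj.symm hcb) with h | h
    · exact absurd h hcd
    · exact SimpleGraph.Adj.symm h

open Classical in
/-- The coordinate projection of `V` onto `V_lam`. -/
noncomputable def restrV (lam : Component G) : (S → ℚ) →ₗ[ℚ] (S → ℚ) where
  toFun v a := if toComponent G a = lam then v a else 0
  map_add' v w := by ext a; simp only [Pi.add_apply]; split_ifs <;> simp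
  map_smul' c v := by ext a; simp only [Pi.smul_apply, RingHom.id_apply]; split_ifs <;> simp

open Classical in
lemma restrV_apply (lam : Component G) (v : S → ℚ) (a : S) :
    restrV lam v a = if toComponent G a = lam then v a else 0 := rfl

lemma mem_compV_iff {lam : Component G} {v : S → ℚ} :
    v ∈ compV G lam ↔ ∀ a, toComponent G a ≠ lam → v a = 0 := by
  constructor
  · intro hv a ha
    have hle : compV G lam ≤ LinearMap.ker (LinearMap.proj a : (S → ℚ) →ₗ[ℚ] ℚ) := by
      refine Submodule.span_le.2 ?_
      rintro _ ⟨b, hb, rfl⟩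
      have hab : a ≠ b := fun e => ha (e ▸ hb)
      simp [hab]
    exact hle hv
  · intro h
    rw [eq_sum_smul_single v]
    refine Submodule.sum_mem _ fun a _ => ?_
    by_cases ha : toComponent G a = lam
    · exact Submodule.smul_mem _ _ ((single_mem_compV_iff G a lam).2 ha)
    · rw [h a ha, zero_smul]
      exact Submodule.zero_mem _

lemma restrV_mem (lam : Component G) (v : S → ℚ) : restrV lam v ∈ compV G lam :=
  mem_compV_iff.2 fun a ha => by rw [restrV_apply, if_neg ha]

lemma restrV_of_mem {lam : Component G} {v : S → ℚ} (hv : v ∈ compV G lam) :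
    restrV lam v = v := by
  ext a
  rw [restrV_apply]
  split_ifs with h
  · rfl
  · exact (mem_compV_iff.1 hv a h).symm

lemma restrV_of_mem_of_ne {lam mu : Component G} (h : mu ≠ lam) {v : S → ℚ}
    (hv : v ∈ compV G mu) : restrV lam v = 0 := by
  ext a
  rw [restrV_apply]
  split_ifs with ha
  · exact mem_compV_iff.1 hv a fun e => h (e.symm.trans ha)
  · rfl

lemma mem_flag_of_mem_compV {a : S} {v : S → ℚ} (hv : v ∈ compV G (toComponent G a)) :
    v ∈ flag G a := by
  intro b hb
  have : toComponent G b = toComponent G a := by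
    by_contra h
    exact hb (mem_compV_iff.1 hv b h)
  exact (toComponent_eq_iff.1 this).1

/-- The projection of `n_G` onto `V_lam` along `W` and the other components. -/
noncomputable def toComp (lam : Component G) : LieAlg G →ₗ[ℚ] comp G lam :=
  LinearMap.codRestrict _ (inclV G ∘ₗ restrV lam ∘ₗ projV G) fun _ =>
    ⟨_, restrV_mem lam _, rfl⟩

lemma coe_toComp (lam : Component G) (x : LieAlg G) :
    (toComp lam x : LieAlg G) = inclV G (restrV lam (projV G x)) := rfl

lemma toComp_of_mem {lam : Component G} {x : LieAlg G} (hx : x ∈ comp G lam) :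
    (toComp lam x : LieAlg G) = x := by
  obtain ⟨v, hv, rfl⟩ := hx
  rw [coe_toComp, projV_inclV, restrV_of_mem hv]

lemma toComp_coe {lam : Component G} (x : comp G lam) : toComp lam (x : LieAlg G) = x :=
  Subtype.ext (toComp_of_mem x.2)

lemma toComp_of_mem_of_ne {lam mu : Component G} (h : mu ≠ lam) {x : LieAlg G}
    (hx : x ∈ comp G mu) : toComp lam x = 0 := by
  obtain ⟨v, hv, rfl⟩ := hx
  refine Subtype.ext ?_
  rw [coe_toComp, projV_inclV, restrV_of_mem_of_ne h hv, map_zero]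
  rfl

lemma toComp_inclW (lam : Component G) (w : W G) : toComp lam (inclW G w) = 0 := by
  refine Subtype.ext ?_
  rw [coe_toComp, projV_inclW, map_zero, map_zero]
  rfl

lemma single_mem_comp (a : S) : inclV G (Pi.single a 1) ∈ comp G (toComponent G a) :=
  ⟨_, (single_mem_compV_iff G a _).2 rfl, rfl⟩

/-- Linear maps on `n_G` that agree on the components and on `W` are equal. -/
lemma hom_ext_comp {M : Type*} [AddCommGroup M] [Module ℚ M] {k l : LieAlg G →ₗ[ℚ] M}
    (hV : ∀ lam, ∀ x ∈ comp G lam, k x = l x) (hW : ∀ w, k (inclW G w) = l (inclW G w)) :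
    k = l := by
  refine LinearMap.prod_ext (LinearMap.pi_ext' fun a => LinearMap.ext_ring ?_)
    (LinearMap.ext hW)
  exact hV _ _ (single_mem_comp a)

lemma exists_injective_map_comp {φ : LieAlg G ≃ₗ⁅ℚ⁆ LieAlg G} (hφ : φ ∈ levi G) :
    ∃ s : Component G → Component G, Function.Injective s ∧
      ∀ lam, ∀ x ∈ comp G lam, φ x ∈ comp G (s lam) := by
  obtain ⟨σ, g, hg, h⟩ := hφ
  refine ⟨componentMap G σ, Function.LeftInverse.injective (componentMap_symm G σ), ?_⟩
  rintro lam _ ⟨v, hv, rfl⟩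
  exact ⟨_, permV_mem G σ (hg.mem hv), (h v).symm⟩

/-- Levi elements intertwine the projections onto the components. -/
lemma map_toComp {φ : LieAlg G ≃ₗ⁅ℚ⁆ LieAlg G} (hφ : φ ∈ levi G) {lam mu : Component G}
    (h : (comp G lam).map (φ.toLinearEquiv : LieAlg G →ₗ[ℚ] LieAlg G) = comp G mu)
    (x : LieAlg G) : φ (toComp lam x) = toComp mu (φ x) := by
  obtain ⟨s, hs, hmem⟩ := exists_injective_map_comp hφ
  have hlam : s lam = mu := by
    obtain ⟨a, rfl⟩ := exists_toComponent_eq lam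
    have h1 := hmem _ _ (single_mem_comp a)
    have h2 : φ (inclV G (Pi.single a 1)) ∈ comp G mu := h ▸ ⟨_, single_mem_comp a, rfl⟩
    by_contra hne
    have h3 := toComp_of_mem_of_ne hne h1
    have h4 := toComp_of_mem h2
    rw [h3] at h4
    have h5 : inclV G (Pi.single a 1) = 0 := φ.injective (h4.symm.trans (map_zero φ).symm)
    have h6 := congrFun (inclV_injective G (h5.trans (map_zero _).symm)) a
    simp at h6
  refine LinearMap.congr_fun (hom_ext_comp
    (k := (φ.toLinearEquiv : LieAlg G →ₗ[ℚ] LieAlg G) ∘ₗ (comp G lam).subtype ∘ₗ toComp lam)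
    (l := (comp G mu).subtype ∘ₗ toComp mu ∘ₗ (φ.toLinearEquiv : LieAlg G →ₗ[ℚ] LieAlg G))
    (fun nu x hx => ?_) (fun w => ?_)) x
  · change φ (toComp lam x) = toComp mu (φ x)
    have h1 := hmem _ _ hx
    by_cases hnu : nu = lam
    · subst hnu
      rw [toComp_of_mem hx, toComp_of_mem (hlam ▸ h1)]
    · rw [toComp_of_mem_of_ne hnu hx,
        toComp_of_mem_of_ne (fun e => hnu (hs (e.trans hlam.symm))) h1]
      exact map_zero φ
  · change φ (toComp lam (inclW G w)) = toComp mu (φ (inclW G w))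
    rw [map_inclW, toComp_inclW, toComp_inclW]
    exact map_zero φ

end Projections

/-! ### Diagonal blocks of flag-preserving automorphisms -/

section DiagonalBlocks

variable {S : Type u} [Fintype S] [DecidableEq S] {G : SimpleGraph S}

/-- The diagonal block at `V_lam` of an automorphism. -/
noncomputable def diagBlock (Φ : LieAlg G ≃ₗ⁅ℚ⁆ LieAlg G) (lam : Component G) :
    comp G lam →ₗ[ℚ] comp G lam :=
  toComp lam ∘ₗ (Φ.toLinearEquiv : LieAlg G →ₗ[ℚ] LieAlg G) ∘ₗ (comp G lam).subtype

lemma diagBlock_apply (Φ : LieAlg G ≃ₗ⁅ℚ⁆ LieAlg G) {lam : Component G} (x : comp G lam) :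
    diagBlock Φ lam x = toComp lam (Φ x) := rfl

/-- If the automorphism preserves the flags, then its diagonal block at `V_lam` is the map induced
on the quotient of the flag of `lam` by the flags strictly below. -/
lemma toComp_map_of_mem_flag {Φ : LieAlg G ≃ₗ⁅ℚ⁆ LieAlg G}
    (hΦ : ∀ a, ∀ y ∈ flag G a, vPart Φ y ∈ flag G a) {a : S} {x : LieAlg G}
    (hx : projV G x ∈ flag G a) :
    toComp (toComponent G a) (Φ x)
      = diagBlock Φ (toComponent G a) (toComp (toComponent G a) x) := by
  refine Subtype.ext ?_
  rw [diagBlock_apply, coe_toComp, coe_toComp, projV_map, projV_map, coe_toComp, projV_inclV]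
  congr 1
  rw [← sub_eq_zero, ← map_sub, ← map_sub]
  set u := projV G x - restrV (toComponent G a) (projV G x) with hu
  ext c
  rw [restrV_apply]
  split_ifs with hc
  · rw [eq_sum_smul_single u]
    simp only [map_sum, map_smul, Finset.sum_apply, Pi.smul_apply, smul_eq_mul, Pi.zero_apply]
    refine Finset.sum_eq_zero fun b _ => ?_
    -- `u` only involves vertices strictly below `a`, whose flags do not meet its component
    by_contra hne
    have hub := left_ne_zero_of_mul hne
    have hcb : Prec G c b := by
      refine hΦ b (Pi.single b 1) (fun d hd => ?_) c (right_ne_zero_of_mul hne)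
      obtain rfl : d = b := by
        by_contra h
        exact hd (by simp [h])
      exact prec_refl G d
    rw [hu, Pi.sub_apply, restrV_apply] at hub
    split_ifs at hub with hb
    · exact hub (sub_self _)
    · rw [sub_zero] at hub
      exact hb (toComponent_eq_iff.2
        ⟨hx b hub, prec_trans G (toComponent_eq_iff.1 hc).2 hcb⟩)
  · rfl

lemma diagBlock_surjective {Φ : LieAlg G ≃ₗ⁅ℚ⁆ LieAlg G}
    (hΦ : ∀ a, ∀ y ∈ flag G a, vPart Φ y ∈ flag G a) (lam : Component G) :
    Function.Surjective (diagBlock Φ lam) := by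
  obtain ⟨a, rfl⟩ := exists_toComponent_eq lam
  rintro ⟨_, v, hv, rfl⟩
  have hinj : Function.Injective ((vPart Φ).restrict (hΦ a)) := fun x y h =>
    Subtype.ext (((Module.End.isUnit_iff _).1 (isUnit_vPart Φ)).1 (congrArg Subtype.val h))
  obtain ⟨⟨u, hu⟩, huv⟩ := LinearMap.surjective_of_injective hinj ⟨v, mem_flag_of_mem_compV hv⟩
  have huv' : vPart Φ u = v := congrArg Subtype.val huv
  refine ⟨toComp _ (inclV G u), ?_⟩
  rw [← toComp_map_of_mem_flag hΦ (show projV G (inclV G u) ∈ flag G a from hu)]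
  refine Subtype.ext ?_
  rw [coe_toComp, projV_map, projV_inclV, huv', restrV_of_mem hv]

/-- A functional on `V` that comes from a left eigenvector of the diagonal block at the component of
`a`: it only depends on the coordinates in this component, and is a left eigenvector on the flag of
`a`. -/
structure IsFlagEigenfunctional (Φ : LieAlg G ≃ₗ⁅ℚ⁆ LieAlg G) (a : S) (μ : ℂ)
    (ξ : (S → ℚ) →ₗ[ℚ] ℂ) : Prop where
  ne_zero : ξ ≠ 0
  apply_restrV : ∀ v, ξ (restrV (toComponent G a) v) = ξ v
  apply_map : ∀ v ∈ flag G a, ξ (vPart Φ v) = μ * ξ v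

namespace IsFlagEigenfunctional

variable {Φ : LieAlg G ≃ₗ⁅ℚ⁆ LieAlg G} {a b : S} {μ ν : ℂ} {ξ η : (S → ℚ) →ₗ[ℚ] ℂ}

lemma exists_mem_compV (h : IsFlagEigenfunctional Φ a μ ξ) :
    ∃ v ∈ compV G (toComponent G a), ξ v ≠ 0 := by
  obtain ⟨v, hv⟩ : ∃ v, ξ v ≠ 0 := by
    by_contra! h0
    exact h.ne_zero (LinearMap.ext h0)
  exact ⟨_, restrV_mem _ v, by rwa [h.apply_restrV]⟩

lemma apply_single (h : IsFlagEigenfunctional Φ a μ ξ) {c : S}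
    (hc : toComponent G c ≠ toComponent G a) : ξ (Pi.single c 1) = 0 := by
  rw [← h.apply_restrV,
    restrV_of_mem_of_ne hc ((single_mem_compV_iff G c _).2 rfl), map_zero]

lemma apply_of_mem_flag (h : IsFlagEigenfunctional Φ a μ ξ) (hab : ¬ Prec G a b) {v : S → ℚ}
    (hv : v ∈ flag G b) : ξ v = 0 := by
  rw [← h.apply_restrV]
  convert map_zero ξ
  ext c
  rw [restrV_apply]
  split_ifs with hc
  · by_contra hne
    exact hab (prec_trans G (toComponent_eq_iff.1 hc).2 (hv c hne))
  · rfl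

lemma of_toComponent_eq (h : IsFlagEigenfunctional Φ a μ ξ)
    (hab : toComponent G a = toComponent G b) : IsFlagEigenfunctional Φ b μ ξ :=
  ⟨h.ne_zero, hab ▸ h.apply_restrV, fun v hv => h.apply_map v fun c hc =>
    prec_trans G (hv c hc) (toComponent_eq_iff.1 hab).2⟩

/-- Left eigenvectors at two components joined by an edge, with eigenvalues `μ` and `ν`, have a
wedge product that is a left eigenvector on the brackets of the two flags. So `μ * ν` is an
eigenvalue, unless the two components and the two eigenvalues agree, in which case the wedge product
may vanish. -/
lemma mul_mem_aroots (hΦ : ∀ a, ∀ y ∈ flag G a, vPart Φ y ∈ flag G a)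
    (hξ : IsFlagEigenfunctional Φ a μ ξ) (hη : IsFlagEigenfunctional Φ b ν η)
    (hab : G.Adj a b) (hne : toComponent G a = toComponent G b → μ ≠ ν) :
    μ * ν ∈ (Φ.toLinearEquiv : LieAlg G →ₗ[ℚ] LieAlg G).charpoly.aroots ℂ := by
  let B : (S → ℚ) →ₗ[ℚ] (S → ℚ) →ₗ[ℚ] ℂ :=
    LinearMap.mk₂ ℚ (fun x y => ξ x * η y - ξ y * η x)
      (fun x y z => by simp only [map_add]; ring)
      (fun c x y => by simp only [map_smul]; simp only [Algebra.smul_def]; ring)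
      (fun x y z => by simp only [map_add]; ring)
      (fun c x y => by simp only [map_smul]; simp only [Algebra.smul_def]; ring)
  have hB : ∀ x y, B x y = ξ x * η y - ξ y * η x := fun _ _ => rfl
  have hzero : ∀ c d, ¬ G.Adj c d → c ≠ d → ξ (Pi.single c 1) * η (Pi.single d 1) = 0 := by
    intro c d hcd hcd'
    by_cases hc : toComponent G c = toComponent G a
    · by_cases hd : toComponent G d = toComponent G b
      · exact absurd (adj_of_toComponent_eq hab hc hd hcd') hcd
      · rw [hη.apply_single hd, mul_zero]
    · rw [hξ.apply_single hc, zero_mul]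
  obtain ⟨k, hk⟩ := exists_factor_bracketV (G := G) B
    (fun x => by rw [hB, sub_self])
    (fun c d hcd => by
      rw [hB]
      by_cases h : c = d
      · rw [h, sub_self]
      · rw [hzero c d hcd h, hzero d c (fun h' => hcd h'.symm) (Ne.symm h), sub_zero])
  have hBf : ∀ x ∈ flag G a, ∀ y ∈ flag G b, B (vPart Φ x) (vPart Φ y) = μ * ν * B x y := by
    intro x hx y hy
    rw [hB, hB, hξ.apply_map x hx, hη.apply_map y hy]
    by_cases h : toComponent G a = toComponent G b
    · rw [(hξ.of_toComponent_eq h).apply_map y hy, (hη.of_toComponent_eq h.symm).apply_map x hx]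
      ring
    · by_cases h1 : Prec G a b
      · have h2 : ¬ Prec G b a := fun h2 => h (toComponent_eq_iff.2 ⟨h1, h2⟩)
        rw [hη.apply_of_mem_flag h2 hx, hη.apply_of_mem_flag h2 (hΦ a x hx)]
        ring
      · rw [hξ.apply_of_mem_flag h1 hy, hξ.apply_of_mem_flag h1 (hΦ b y hy)]
        ring
  have hBne : ∃ x ∈ flag G a, ∃ y ∈ flag G b, B x y ≠ 0 := by
    obtain ⟨x, hx, hx0⟩ := hξ.exists_mem_compV
    obtain ⟨y, hy, hy0⟩ := hη.exists_mem_compV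
    by_cases h : toComponent G a = toComponent G b
    · -- if the wedge product vanished, testing it on `x` and its image would give `ν = μ` or
      -- `η x = 0`, and the latter contradicts its vanishing on `x` and `y`
      by_contra! hall
      have hx' := mem_flag_of_mem_compV hx
      have h1 := hall x hx' y (mem_flag_of_mem_compV hy)
      have h2 := hall x hx' (vPart Φ x) (hΦ b x (mem_flag_of_mem_compV (h ▸ hx)))
      rw [hB, hξ.apply_map x hx', (hη.of_toComponent_eq h.symm).apply_map x hx'] at h2
      have h3 : (ν - μ) * (ξ x * η x) = 0 := by linear_combination h2
      rcases mul_eq_zero.1 h3 with h3 | h3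
      · exact hne h (sub_eq_zero.1 h3).symm
      · rw [hB, (mul_eq_zero.1 h3).resolve_left hx0, mul_zero, sub_zero] at h1
        exact mul_ne_zero hx0 hy0 h1
    · refine ⟨x, mem_flag_of_mem_compV hx, y, mem_flag_of_mem_compV hy, ?_⟩
      have hy1 : ξ y = 0 := by
        rw [← hξ.apply_restrV, restrV_of_mem_of_ne (Ne.symm h) hy, map_zero]
      rw [hB, hy1, zero_mul, sub_zero]
      exact mul_ne_zero hx0 hy0
  let X : Set (W G) := {w | ∃ x ∈ flag G a, ∃ y ∈ flag G b, w = bracketV G x y}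
  have hX : ∀ w ∈ Submodule.span ℚ X,
      wPart Φ w ∈ Submodule.span ℚ X ∧ k (wPart Φ w) = μ * ν * k w := by
    intro w hw
    induction hw using Submodule.span_induction with
    | mem w h =>
      obtain ⟨x, hx, y, hy, rfl⟩ := h
      rw [wPart_bracketV, hk, hk]
      exact ⟨Submodule.subset_span ⟨_, hΦ a x hx, _, hΦ b y hy, rfl⟩, hBf x hx y hy⟩
    | zero => simp
    | add x y _ _ ihx ihy =>
      simp only [map_add]
      exact ⟨Submodule.add_mem _ ihx.1 ihy.1, by rw [ihx.2, ihy.2]; ring⟩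
    | smul c x _ ih =>
      simp only [map_smul, Algebra.smul_def c (k _)]
      exact ⟨Submodule.smul_mem _ _ ih.1, by rw [ih.2]; ring⟩
  obtain ⟨x, hx, y, hy, hxy⟩ := hBne
  refine mem_aroots_charpoly_of_invariant ((Submodule.span ℚ X).map (inclW G)) ?_
    (k ∘ₗ projW G) ?_ (x := inclW G (bracketV G x y))
    ⟨_, Submodule.subset_span ⟨x, hx, y, hy, rfl⟩, rfl⟩ ?_
  · rintro _ ⟨w, hw, rfl⟩
    exact ⟨_, (hX w hw).1, (map_inclW Φ w).symm⟩
  · rintro _ ⟨w, hw, rfl⟩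
    change k (projW G (Φ (inclW G w))) = _
    rw [map_inclW]
    exact (hX w hw).2
  · change k (bracketV G x y) ≠ 0
    rwa [hk]

end IsFlagEigenfunctional

lemma exists_isFlagEigenfunctional {Φ : LieAlg G ≃ₗ⁅ℚ⁆ LieAlg G}
    (hΦ : ∀ a, ∀ y ∈ flag G a, vPart Φ y ∈ flag G a) {a : S} {μ : ℂ}
    (hμ : μ ∈ (diagBlock Φ (toComponent G a)).charpoly.aroots ℂ) :
    ∃ ξ, IsFlagEigenfunctional Φ a μ ξ := by
  obtain ⟨l, h0, hl⟩ := mem_aroots_charpoly_iff_exists_functional.1 hμ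
  refine ⟨l ∘ₗ toComp _ ∘ₗ inclV G, fun h => h0 ?_, fun v => ?_, fun v hv => ?_⟩
  · ext ⟨_, v, hv, rfl⟩
    have := LinearMap.congr_fun h v
    rwa [LinearMap.comp_apply, LinearMap.comp_apply,
      show toComp (toComponent G a) (inclV G v) = ⟨inclV G v, v, hv, rfl⟩ from
        Subtype.ext (toComp_of_mem ⟨v, hv, rfl⟩)] at this
  · change l (toComp _ (toComp _ (inclV G v) : LieAlg G)) = l (toComp _ (inclV G v))
    rw [toComp_coe]
  · have h1 := toComp_map_of_mem_flag hΦ (show projV G (inclV G v) ∈ flag G a from hv)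
    have h2 : toComp (toComponent G a) (inclV G (vPart Φ v))
        = toComp (toComponent G a) (Φ (inclV G v)) := by
      refine Subtype.ext ?_
      rw [coe_toComp, coe_toComp, projV_map, projV_inclV, projV_inclV]
    change l (toComp _ (inclV G (vPart Φ v))) = μ * l (toComp _ (inclV G v))
    rw [h2, h1, hl]

lemma mem_aroots_of_mem_aroots_diagBlock {Φ : LieAlg G ≃ₗ⁅ℚ⁆ LieAlg G}
    (hΦ : ∀ a, ∀ y ∈ flag G a, vPart Φ y ∈ flag G a) {lam : Component G} {μ : ℂ}
    (hμ : μ ∈ (diagBlock Φ lam).charpoly.aroots ℂ) :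
    μ ∈ (Φ.toLinearEquiv : LieAlg G →ₗ[ℚ] LieAlg G).charpoly.aroots ℂ := by
  obtain ⟨a, rfl⟩ := exists_toComponent_eq lam
  obtain ⟨ξ, hξ⟩ := exists_isFlagEigenfunctional hΦ hμ
  obtain ⟨v, hv, hv0⟩ := hξ.exists_mem_compV
  refine mem_aroots_charpoly_of_invariant ((flag G a).comap (projV G)) (fun x hx => ?_)
    (ξ ∘ₗ projV G) (fun x hx => ?_) (x := inclV G v) (mem_flag_of_mem_compV hv) hv0
  · change projV G (Φ x) ∈ flag G a
    rw [projV_map]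
    exact hΦ a _ hx
  · change ξ (projV G (Φ x)) = _
    rw [projV_map]
    exact hξ.apply_map _ hx

end DiagonalBlocks

/-! ### From an Anosov automorphism to its diagonal blocks -/

section Necessity

variable {S : Type u} [Fintype S] [DecidableEq S] {G : SimpleGraph S}
  {H : Type v} [Group H] {ρ : H →* (LieAlg G ≃ₗ⁅ℚ⁆ LieAlg G)}

lemma inv_apply_apply (h : H) (x : LieAlg G) : ρ h⁻¹ (ρ h x) = x := by
  rw [map_inv]
  exact (ρ h).symm_apply_apply x

lemma apply_inv_apply (h : H) (x : LieAlg G) : ρ h (ρ h⁻¹ x) = x := by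
  rw [map_inv]
  exact (ρ h).apply_symm_apply x

lemma Moves.mem {h : H} {lam mu : Component G} (hm : Moves ρ h lam mu) {x : LieAlg G}
    (hx : x ∈ comp G lam) : ρ h x ∈ comp G mu :=
  hm ▸ ⟨x, hx, rfl⟩

lemma Moves.inv {h : H} {lam mu : Component G} (hm : Moves ρ h lam mu) :
    Moves ρ h⁻¹ mu lam := by
  ext x
  constructor
  · rintro ⟨y, hy, rfl⟩
    obtain ⟨z, hz, rfl⟩ : y ∈ (comp G lam).map ((ρ h).toLinearEquiv : LieAlg G →ₗ[ℚ] LieAlg G) :=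
      hm ▸ hy
    change ρ h⁻¹ (ρ h z) ∈ comp G lam
    rwa [inv_apply_apply]
  · intro hxm
    exact ⟨ρ h x, hm.mem hxm, inv_apply_apply h x⟩

/-- Diagonal blocks at components in the same orbit are conjugate, so share their eigenvalues. -/
lemma mem_aroots_diagBlock_of_moves (hρ : ∀ h, ρ h ∈ levi G) {Φ : LieAlg G ≃ₗ⁅ℚ⁆ LieAlg G}
    (hcomm : ∀ h, Commute Φ (ρ h)) {h : H} {lam mu : Component G} (hm : Moves ρ h lam mu) {μ : ℂ}
    (hμ : μ ∈ (diagBlock Φ lam).charpoly.aroots ℂ) :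
    μ ∈ (diagBlock Φ mu).charpoly.aroots ℂ := by
  obtain ⟨l, h0, hl⟩ := mem_aroots_charpoly_iff_exists_functional.1 hμ
  refine mem_aroots_charpoly_iff_exists_functional.2
    ⟨l ∘ₗ toComp lam ∘ₗ ((ρ h⁻¹).toLinearEquiv : LieAlg G →ₗ[ℚ] LieAlg G) ∘ₗ
      (comp G mu).subtype, fun he => h0 ?_, fun y => ?_⟩
  · ext x
    have h1 := LinearMap.congr_fun he ⟨ρ h x, hm.mem x.2⟩
    change l (toComp lam (ρ h⁻¹ (ρ h x))) = 0 at h1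
    rwa [inv_apply_apply, toComp_coe] at h1
  · change l (toComp lam (ρ h⁻¹ (toComp mu (Φ y)))) = μ * l (toComp lam (ρ h⁻¹ y))
    have h1 : ρ h⁻¹ (Φ y) = Φ (ρ h⁻¹ y) :=
      (DFunLike.congr_fun (hcomm h⁻¹).eq (y : LieAlg G)).symm
    rw [map_toComp (hρ h⁻¹) hm.inv, toComp_coe, h1, ← hl, diagBlock_apply,
      toComp_of_mem (hm.inv.mem y.2)]

/-- An Anosov automorphism that commutes with `ρ(H)` has a power that preserves all flags, and the
diagonal blocks of this power are as required. -/
lemma exists_of_isAnosov (hρ : ∀ h, ρ h ∈ levi G) {φ : LieAlg G ≃ₗ⁅ℚ⁆ LieAlg G}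
    (hφ : IsAnosov φ) (hcomm : ∀ h, Commute φ (ρ h)) (lam : Component G) :
    ∃ ψ : comp G lam ≃ₗ[ℚ] comp G lam,
      IsHyperbolicOfClass (cNumber ρ lam) (ψ : comp G lam →ₗ[ℚ] comp G lam) ∧
      IsIntegerLike (ψ : comp G lam →ₗ[ℚ] comp G lam) ∧
      ∀ h : stab ρ lam, Commute ψ (stabRep ρ lam h) := by
  obtain ⟨m, hm, hΦ⟩ := exists_pow_map_flag φ
  have hcommΦ : ∀ h, Commute (φ ^ m) (ρ h) := fun h => (hcomm h).pow_left m
  have hev : ∀ μ ∈ ((φ ^ m).toLinearEquiv : LieAlg G →ₗ[ℚ] LieAlg G).charpoly.aroots ℂ,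
      ‖μ‖ ≠ 1 ∧ IsAlgebraicUnit μ := by
    intro μ hμ
    rw [toLinear_pow] at hμ
    obtain ⟨ν, hν, rfl⟩ := exists_pow_eq_of_mem_aroots_charpoly_pow hm hμ
    have := isAnosov_iff.1 hφ ν hν
    refine ⟨?_, this.2.pow m⟩
    rw [norm_pow, Ne, pow_eq_one_iff_of_nonneg (norm_nonneg _) hm.ne']
    exact this.1
  set Φ := φ ^ m with hΦdef
  have hs := diagBlock_surjective hΦ lam
  let ψ : comp G lam ≃ₗ[ℚ] comp G lam :=
    LinearEquiv.ofBijective (diagBlock Φ lam) ⟨LinearMap.injective_iff_surjective.2 hs, hs⟩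
  have hψ : (ψ : comp G lam →ₗ[ℚ] comp G lam) = diagBlock Φ lam := LinearMap.ext fun _ => rfl
  refine ⟨ψ, ?_, ?_, fun h => ?_⟩
  · rw [hψ, cNumber]
    split_ifs with hc
    · obtain ⟨a, b, ⟨h, ha⟩, ⟨k, hb⟩, hab⟩ := hc
      refine isHyperbolicOfClass_two_iff.2
        ⟨fun μ hμ => (hev μ (mem_aroots_of_mem_aroots_diagBlock hΦ hμ)).1, fun μ hμ ν hν => ?_⟩
      obtain ⟨ξ, hξ⟩ := exists_isFlagEigenfunctional hΦ
        (mem_aroots_diagBlock_of_moves hρ hcommΦ ha hμ)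
      obtain ⟨η, hη⟩ := exists_isFlagEigenfunctional hΦ
        (mem_aroots_diagBlock_of_moves hρ hcommΦ hb hν)
      -- for `μ = ν` the wedge product may vanish, but then `‖μ‖ ≠ 1` suffices
      by_cases hμν : μ = ν
      · subst hμν
        have := (hev μ (mem_aroots_of_mem_aroots_diagBlock hΦ hμ)).1
        rwa [← pow_two, Ne, pow_eq_one_iff_of_nonneg (norm_nonneg _) two_ne_zero]
      · rw [← norm_mul]
        exact (hev _ (hξ.mul_mem_aroots hΦ hη hab fun _ => hμν)).1
    · exact isHyperbolicOfClass_one_iff.2 fun μ hμ =>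
        (hev μ (mem_aroots_of_mem_aroots_diagBlock hΦ hμ)).1
  · rw [hψ]
    exact isIntegerLike_iff.2 fun μ hμ => (hev μ (mem_aroots_of_mem_aroots_diagBlock hΦ hμ)).2
  · refine LinearEquiv.ext fun x => Subtype.ext ?_
    change (toComp lam (Φ (ρ h x)) : LieAlg G) = ρ h (toComp lam (Φ x))
    rw [map_toComp (hρ h) h.2]
    congr 2
    exact DFunLike.congr_fun (hcommΦ h).eq (x : LieAlg G)

end Necessity

/-! ### Automorphisms from block-diagonal maps -/

section Extension

variable {S : Type u} [Fintype S] [DecidableEq S] {G : SimpleGraph S}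

lemma map_inclV_of_mem_levi {φ : LieAlg G ≃ₗ⁅ℚ⁆ LieAlg G} (hφ : φ ∈ levi G) (v : S → ℚ) :
    φ (inclV G v) = inclV G (vPart φ v) := by
  obtain ⟨σ, g, -, h⟩ := hφ
  rw [← projV_inclV G v, ← projV_map, projV_inclV, h, projV_inclV]

lemma lieEquiv_ext {φ ψ : LieAlg G ≃ₗ⁅ℚ⁆ LieAlg G}
    (h : ∀ v, φ (inclV G v) = ψ (inclV G v)) : φ = ψ := by
  have hv : vPart φ = vPart ψ := LinearMap.ext fun v => congrArg (projV G) (h v)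
  have hw : wPart φ = wPart ψ := hom_ext_W fun x y => by rw [wPart_bracketV, wPart_bracketV, hv]
  refine LieEquiv.ext fun x => ?_
  rw [← inclV_projV_add x, map_add, map_add, h, map_inclW, map_inclW, hw]

/-- Block-diagonal automorphisms of `V` extend to `n_G`: vertices in the components of two
distinct nonadjacent vertices are not adjacent. -/
lemma exists_lieEquiv_of_block {f : (S → ℚ) →ₗ[ℚ] (S → ℚ)} (hs : Function.Surjective f)
    (hf : ∀ lam, ∀ v ∈ compV G lam, f v ∈ compV G lam) :
    ∃ φ : LieAlg G ≃ₗ⁅ℚ⁆ LieAlg G, ∀ v, φ (inclV G v) = inclV G (f v) := by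
  obtain ⟨k, hk⟩ := exists_factor_bracketV (G := G) ((bracketHom G).compl₁₂ f f)
    (fun x => bracketV_self G (f x)) (fun a b hab => by
      change bracketV G (f (Pi.single a 1)) (f (Pi.single b 1)) = 0
      by_cases h : a = b
      · rw [h, bracketV_self]
      refine Finset.sum_eq_zero fun c _ => Finset.sum_eq_zero fun d _ => ?_
      have hfa := mem_compV_iff.1 (hf _ _ ((single_mem_compV_iff G a _).2 rfl)) c
      have hfb := mem_compV_iff.1 (hf _ _ ((single_mem_compV_iff G b _).2 rfl)) d
      by_cases hc : toComponent G c = toComponent G a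
      · by_cases hd : toComponent G d = toComponent G b
        · rw [basisBracket, dif_neg, smul_zero]
          exact fun hcd => hab (adj_of_toComponent_eq hcd hc.symm hd.symm h)
        · rw [hfb hd, mul_zero, zero_smul]
      · rw [hfa hc, zero_mul, zero_smul])
  have hks : Function.Surjective k := by
    rw [← LinearMap.range_eq_top, eq_top_iff]
    intro w _
    refine Submodule.span_le.2 ?_ (mem_span_bracketV w)
    rintro _ ⟨⟨x, y⟩, rfl⟩
    obtain ⟨x, rfl⟩ := hs x
    obtain ⟨y, rfl⟩ := hs y
    exact ⟨_, hk x y⟩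
  let F : LieAlg G →ₗ[ℚ] LieAlg G := LinearMap.prodMap f k
  have hFV : ∀ v, F (inclV G v) = inclV G (f v) := fun v => Prod.ext rfl (map_zero k)
  have hFW : ∀ w, F (inclW G w) = inclW G (k w) := fun w => Prod.ext (map_zero f) rfl
  have hFs : Function.Surjective F := by
    intro x
    obtain ⟨v, hv⟩ := hs (projV G x)
    obtain ⟨w, hw⟩ := hks (projW G x)
    refine ⟨inclV G v + inclW G w, ?_⟩
    rw [map_add, hFV, hFW, hv, hw, inclV_projV_add]
  let E : LieAlg G →ₗ⁅ℚ⁆ LieAlg G :=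
    { F with
      map_lie' := fun {x y} => by
        change F (inclW G (bracketV G (projV G x) (projV G y)))
          = inclW G (bracketV G (projV G (F x)) (projV G (F y)))
        rw [hFW, hk]
        rfl }
  exact ⟨LieEquiv.ofBijective E ⟨LinearMap.injective_iff_surjective.2 hFs, hFs⟩, hFV⟩

end Extension

/-! ### Gluing along the orbits of components -/

section Sufficiency

variable {S : Type u} [Fintype S] [DecidableEq S] {G : SimpleGraph S}
  {H : Type v} [Group H] {ρ : H →* (LieAlg G ≃ₗ⁅ℚ⁆ LieAlg G)}

lemma moves_one (lam : Component G) : Moves ρ 1 lam lam := (stab ρ lam).one_mem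

lemma Moves.mul {h k : H} {lam mu nu : Component G} (hk : Moves ρ k mu nu)
    (hh : Moves ρ h lam mu) : Moves ρ (k * h) lam nu := by
  ext x
  constructor
  · rintro ⟨y, hy, rfl⟩
    change ρ (k * h) y ∈ comp G nu
    rw [map_mul]
    exact hk.mem (hh.mem hy)
  · intro hx
    refine ⟨ρ (k * h)⁻¹ x, ?_, ?_⟩
    · rw [mul_inv_rev, map_mul]
      exact hh.inv.mem (hk.inv.mem hx)
    · change ρ (k * h) (ρ (k * h)⁻¹ x) = x
      exact apply_inv_apply _ x

/-- Representatives of the orbits on the components, with elements that move them to the given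
components. -/
lemma exists_orbit_representatives (ρ : H →* (LieAlg G ≃ₗ⁅ℚ⁆ LieAlg G)) :
    ∃ (rep : Component G → Component G) (g : Component G → H),
      (∀ lam, Moves ρ (g lam) (rep lam) lam) ∧
      ∀ h lam mu, Moves ρ h lam mu → rep mu = rep lam := by
  let s : Setoid (Component G) :=
    { r := fun lam mu => ∃ h, Moves ρ h lam mu
      iseqv := ⟨fun lam => ⟨1, moves_one lam⟩, fun ⟨h, hm⟩ => ⟨h⁻¹, hm.inv⟩,
        fun ⟨h, hm⟩ ⟨k, km⟩ => ⟨k * h, km.mul hm⟩⟩ }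
  have hrep : ∀ lam : Component G, ∃ h, Moves ρ h (Quotient.mk s lam).out lam := fun lam =>
    Quotient.exact (Quotient.out_eq (Quotient.mk s lam))
  choose g hg using hrep
  refine ⟨fun lam => (Quotient.mk s lam).out, g, hg, fun h lam mu hm => ?_⟩
  exact congrArg Quotient.out (Quotient.sound (s := s) ⟨h, hm⟩).symm

/-- Maps on the components of orbit representatives that commute with the stabilizers glue, by
conjugation, to a block-diagonal map that commutes with `ρ(H)`. -/
lemma exists_equivariant_block (hρ : ∀ h, ρ h ∈ levi G) {rep : Component G → Component G}
    {g : Component G → H} (hg : ∀ lam, Moves ρ (g lam) (rep lam) lam)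
    (hrep : ∀ h lam mu, Moves ρ h lam mu → rep mu = rep lam)
    (χ : ∀ lam : Component G, comp G lam →ₗ[ℚ] comp G lam)
    (hχ : ∀ lam, ∀ h : stab ρ lam, ∀ x, χ lam (stabRep ρ lam h x) = stabRep ρ lam h (χ lam x)) :
    ∃ f : (S → ℚ) →ₗ[ℚ] (S → ℚ), (∀ lam, ∀ v ∈ compV G lam, f v ∈ compV G lam) ∧
      (∀ h, f ∘ₗ vPart (ρ h) = vPart (ρ h) ∘ₗ f) ∧
      ∀ lam (x : comp G (rep lam)),
        inclV G (f (projV G (ρ (g lam) x))) = ρ (g lam) (χ (rep lam) x) := by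
  classical
  have : Fintype (Component G) := Quotient.fintype (coherent G)
  let E : Component G → LieAlg G →ₗ[ℚ] LieAlg G := fun nu =>
    (comp G nu).subtype ∘ₗ χ nu ∘ₗ toComp nu
  have hE : ∀ nu (x : comp G nu), E nu x = χ nu x := fun nu x => by
    change (χ nu (toComp nu (x : LieAlg G)) : LieAlg G) = _
    rw [toComp_coe]
  have hEcomm : ∀ nu k, Moves ρ k nu nu → ∀ x ∈ comp G nu, E nu (ρ k x) = ρ k (E nu x) := by
    intro nu k hk x hx
    have := congrArg Subtype.val (hχ nu ⟨k, hk⟩ ⟨x, hx⟩)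
    rw [← hE] at this
    refine this.trans ?_
    change ρ k (χ nu ⟨x, hx⟩) = _
    rw [← hE]
  let D : Component G → LieAlg G →ₗ[ℚ] LieAlg G := fun lam =>
    ((ρ (g lam)).toLinearEquiv : LieAlg G →ₗ[ℚ] LieAlg G) ∘ₗ E (rep lam) ∘ₗ
      ((ρ (g lam)⁻¹).toLinearEquiv : LieAlg G →ₗ[ℚ] LieAlg G)
  have hD : ∀ lam x, D lam x = ρ (g lam) (E (rep lam) (ρ (g lam)⁻¹ x)) := fun _ _ => rfl
  have hDmem : ∀ lam x, D lam x ∈ comp G lam := fun lam x => (hg lam).mem (Subtype.prop _)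
  have hDzero : ∀ lam mu, mu ≠ lam → ∀ x ∈ comp G mu, D lam x = 0 := by
    intro lam mu hne x hx
    have h1 : toComp (rep lam) (ρ (g lam)⁻¹ x) = 0 := by
      refine Subtype.ext ?_
      rw [← map_toComp (hρ _) (hg lam).inv, toComp_of_mem_of_ne hne hx]
      exact map_zero _
    change ρ (g lam) (χ (rep lam) (toComp (rep lam) (ρ (g lam)⁻¹ x)) : LieAlg G) = 0
    rw [h1, map_zero]
    exact map_zero _
  let f : (S → ℚ) →ₗ[ℚ] (S → ℚ) := projV G ∘ₗ (∑ lam, D lam) ∘ₗ inclV G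
  have hf : ∀ lam, ∀ v ∈ compV G lam, inclV G (f v) = D lam (inclV G v) := by
    intro lam v hv
    have h1 : (∑ lam, D lam) (inclV G v) = D lam (inclV G v) := by
      rw [LinearMap.sum_apply]
      exact Finset.sum_eq_single lam (fun mu _ hmu => hDzero mu lam hmu.symm _ ⟨v, hv, rfl⟩)
        (fun h => absurd (Finset.mem_univ _) h)
    change inclV G (projV G ((∑ lam, D lam) (inclV G v))) = _
    rw [h1]
    obtain ⟨w, -, hw⟩ := hDmem lam (inclV G v)
    rw [← hw, projV_inclV]
  refine ⟨f, fun lam v hv => ?_, fun h => ?_, fun lam x => ?_⟩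
  · obtain ⟨w, hw, hwv⟩ := hDmem lam (inclV G v)
    rw [← hf lam v hv] at hwv
    exact inclV_injective G hwv ▸ hw
  · refine LinearMap.pi_ext' fun a => LinearMap.ext_ring ?_
    change f (vPart (ρ h) (Pi.single a 1)) = vPart (ρ h) (f (Pi.single a 1))
    set lam := toComponent G a with hlam
    have ha : (Pi.single a 1 : S → ℚ) ∈ compV G lam := (single_mem_compV_iff G a _).2 rfl
    obtain ⟨mu, hmu, -⟩ := existsUnique_map_comp G (hρ h) lam
    have hm : Moves ρ h lam mu := hmu
    have hav : vPart (ρ h) (Pi.single a 1) ∈ compV G mu := by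
      obtain ⟨w, hw, hwv⟩ := hm.mem (single_mem_comp a)
      rw [map_inclV_of_mem_levi (hρ h)] at hwv
      exact inclV_injective G hwv ▸ hw
    refine inclV_injective G ?_
    rw [hf mu _ hav, ← map_inclV_of_mem_levi (hρ h), ← map_inclV_of_mem_levi (hρ h), hf lam _ ha,
      hD, hD, hrep h lam mu hm]
    -- `k` is the element of the stabilizer of the representative that compares the two conjugators
    set k := (g mu)⁻¹ * (h * g lam) with hk
    have hkm : Moves ρ k (rep lam) (rep lam) := by
      have := (hg mu).inv.mul (hm.mul (hg lam))
      rwa [hrep h lam mu hm] at this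
    have h1 : ρ (g mu)⁻¹ (ρ h (inclV G (Pi.single a 1)))
        = ρ k (ρ (g lam)⁻¹ (inclV G (Pi.single a 1))) := by
      rw [hk, map_mul, map_mul]
      change _ = ρ (g mu)⁻¹ (ρ h (ρ (g lam) (ρ (g lam)⁻¹ _)))
      rw [apply_inv_apply]
    rw [h1, hEcomm _ _ hkm _ ((hg lam).inv.mem (single_mem_comp a)), hk, map_mul, map_mul]
    change ρ (g mu) (ρ (g mu)⁻¹ (ρ h (ρ (g lam) _))) = _
    rw [apply_inv_apply]
  · obtain ⟨v, hv, hvx⟩ := (hg lam).mem x.2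
    rw [← hvx, projV_inclV, hf lam v hv, hvx, hD, inv_apply_apply, hE]

/-- The eigenvalues of an automorphism glued from `χ` are eigenvalues of `χ` at representatives,
or products of two of them at components joined by an edge. -/
lemma mem_aroots_of_glued {rep : Component G → Component G}
    {g : Component G → H} (hg : ∀ lam, Moves ρ (g lam) (rep lam) lam)
    {χ : ∀ lam : Component G, comp G lam →ₗ[ℚ] comp G lam}
    (hχ : ∀ lam, Function.Surjective (χ lam)) {φ : LieAlg G ≃ₗ⁅ℚ⁆ LieAlg G}
    (hφ : ∀ lam (x : comp G (rep lam)), φ (ρ (g lam) x) = ρ (g lam) (χ (rep lam) x)) {θ : ℂ}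
    (hθ : θ ∈ (φ.toLinearEquiv : LieAlg G →ₗ[ℚ] LieAlg G).charpoly.aroots ℂ) :
    (∃ lam, θ ∈ (χ lam).charpoly.aroots ℂ) ∨
      ∃ a b, G.Adj a b ∧ ∃ μ ∈ (χ (rep (toComponent G a))).charpoly.aroots ℂ,
        ∃ ν ∈ (χ (rep (toComponent G b))).charpoly.aroots ℂ, μ * ν = θ := by
  obtain ⟨l, hl0, hl⟩ := mem_aroots_charpoly_iff_exists_functional.1 hθ
  have hl' : ∀ x, l (φ x) = θ * l x := hl
  let R : ∀ lam, comp G (rep lam) →ₗ[ℚ] LieAlg G := fun lam =>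
    ((ρ (g lam)).toLinearEquiv : LieAlg G →ₗ[ℚ] LieAlg G) ∘ₗ (comp G (rep lam)).subtype
  have hR : ∀ lam x, R lam x = ρ (g lam) x := fun _ _ => rfl
  have hRs : ∀ a, ∃ x, R (toComponent G a) x = inclV G (Pi.single a 1) := fun a =>
    ⟨⟨_, (hg _).inv.mem (single_mem_comp a)⟩, apply_inv_apply _ _⟩
  by_cases hV : ∃ a, l (inclV G (Pi.single a 1)) ≠ 0
  · obtain ⟨a, ha⟩ := hV
    obtain ⟨x, hx⟩ := hRs a
    refine Or.inl ⟨rep (toComponent G a), mem_aroots_charpoly_iff_exists_functional.2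
      ⟨l ∘ₗ R _, fun h0 => ha ?_, fun y => ?_⟩⟩
    · rw [← hx]
      exact LinearMap.congr_fun h0 x
    · change l (R _ (χ _ y)) = θ * l (R _ y)
      rw [hR, ← hφ, hl', hR]
  · push Not at hV
    obtain ⟨a, b, hab⟩ : ∃ a b, l (inclW G (basisBracket G a b)) ≠ 0 := by
      by_contra! h
      refine hl0 (LinearMap.prod_ext (LinearMap.pi_ext' fun a => LinearMap.ext_ring (hV a))
        (hom_ext_W (k := l ∘ₗ inclW G) (l := 0) fun x y => ?_))
      rw [LinearMap.zero_apply, LinearMap.comp_apply, bracketV]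
      simp only [map_sum, map_smul, h, smul_zero, Finset.sum_const_zero]
    have hadj : G.Adj a b := by
      by_contra h
      rw [basisBracket, dif_neg h, map_zero, map_zero] at hab
      exact hab rfl
    obtain ⟨x, hx⟩ := hRs a
    obtain ⟨y, hy⟩ := hRs b
    let B := LinearMap.mk₂ ℚ (fun x y => l ⁅R (toComponent G a) x, R (toComponent G b) y⁆)
      (fun x y z => by rw [map_add, add_lie, map_add])
      (fun c x y => by rw [map_smul, smul_lie, map_smul])
      (fun x y z => by rw [map_add, lie_add, map_add])
      (fun c x y => by rw [map_smul, lie_smul, map_smul])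
    have hB : ∀ x y, B x y = l ⁅R (toComponent G a) x, R (toComponent G b) y⁆ := fun _ _ => rfl
    refine Or.inr ⟨a, b, hadj, exists_mul_eq_of_bilinear (hχ _) B (fun h0 => ?_) fun x y => ?_⟩
    · have h1 := LinearMap.congr_fun (LinearMap.congr_fun h0 x) y
      rw [hB, hx, hy, lie_basis] at h1
      exact hab h1
    · rw [hB, hB, hR, hR, ← hφ, ← hφ, ← LieEquiv.map_lie, hl', hR, hR]

/-- Gluing powers of the given maps at orbit representatives, with sparse exponents, gives an Anosov
automorphism: products of two eigenvalues from one orbit are excluded by the condition on `c`, and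
those from two different orbits by the choice of the exponents. -/
lemma exists_isAnosov (hρ : ∀ h, ρ h ∈ levi G)
    (ψ : ∀ lam : Component G, comp G lam ≃ₗ[ℚ] comp G lam)
    (hhyp : ∀ lam, IsHyperbolicOfClass (cNumber ρ lam) (ψ lam : comp G lam →ₗ[ℚ] comp G lam))
    (hint : ∀ lam, IsIntegerLike (ψ lam : comp G lam →ₗ[ℚ] comp G lam))
    (hcomm : ∀ lam, ∀ h : stab ρ lam, Commute (ψ lam) (stabRep ρ lam h)) :
    ∃ φ : LieAlg G ≃ₗ⁅ℚ⁆ LieAlg G, IsAnosov φ ∧ ∀ h : H, Commute φ (ρ h) := by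
  have : Finite (Component G) := Quotient.finite (coherent G)
  obtain ⟨rep, g, hg, hrep⟩ := exists_orbit_representatives ρ
  obtain ⟨e, he⟩ : ∃ e : Component G → ℕ, Function.Injective e :=
    ⟨fun lam => (Finite.equivFin _ lam : ℕ), Fin.val_injective.comp (Equiv.injective _)⟩
  let A : Component G → Set ℂ := fun lam =>
    {μ | μ ∈ (ψ lam : comp G lam →ₗ[ℚ] comp G lam).charpoly.aroots ℂ}
  have hunit : ∀ lam, ∀ μ ∈ A lam, IsAlgebraicUnit μ := fun lam =>
    isIntegerLike_iff.1 (hint lam)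
  have hnorm : ∀ lam, ∀ μ ∈ A lam, ‖μ‖ ≠ 1 := by
    intro lam
    have h := hhyp lam
    rw [cNumber] at h
    split_ifs at h
    · exact (isHyperbolicOfClass_two_iff.1 h).1
    · exact isHyperbolicOfClass_one_iff.1 h
  have hfin : (⋃ lam, A lam).Finite := Set.finite_iUnion fun lam => Multiset.finite_toSet _
  obtain ⟨N, hN0, hN⟩ := exists_sparse_exponents hfin fun α hα => by
    obtain ⟨lam, hα⟩ := Set.mem_iUnion.1 hα
    exact ⟨(hunit lam α hα).1, hnorm lam α hα⟩
  let χ : ∀ lam : Component G, comp G lam →ₗ[ℚ] comp G lam := fun lam =>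
    (ψ lam : comp G lam →ₗ[ℚ] comp G lam) ^ N ^ e lam
  have hχroots : ∀ lam, ∀ θ ∈ (χ lam).charpoly.aroots ℂ, ∃ α ∈ A lam, α ^ N ^ e lam = θ :=
    fun lam θ hθ => exists_pow_eq_of_mem_aroots_charpoly_pow (pow_pos hN0 _) hθ
  have hχs : ∀ lam, Function.Surjective (χ lam) := fun lam => by
    change Function.Surjective ⇑((ψ lam : comp G lam →ₗ[ℚ] comp G lam) ^ N ^ e lam)
    rw [Module.End.coe_pow]
    exact (ψ lam).surjective.iterate _
  obtain ⟨f, hfblock, hfcomm, hfg⟩ := exists_equivariant_block hρ hg hrep χ fun lam h x => by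
    have h1 : Commute (ψ lam : Module.End ℚ (comp G lam))
        (stabRep ρ lam h : comp G lam →ₗ[ℚ] comp G lam) :=
      LinearMap.ext fun y => DFunLike.congr_fun (hcomm lam h).eq y
    exact LinearMap.congr_fun (h1.pow_left _).eq x
  have hfs : Function.Surjective f := by
    rw [← LinearMap.range_eq_top, eq_top_iff]
    intro v _
    rw [eq_sum_smul_single v]
    refine Submodule.sum_mem _ fun a _ => Submodule.smul_mem _ _ ?_
    obtain ⟨y, hy⟩ := hχs (rep (toComponent G a))
      ⟨_, (hg (toComponent G a)).inv.mem (single_mem_comp a)⟩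
    refine ⟨projV G (ρ (g (toComponent G a)) y), inclV_injective G ?_⟩
    rw [hfg, hy]
    exact apply_inv_apply _ _
  obtain ⟨φ, hφ⟩ := exists_lieEquiv_of_block hfs hfblock
  have hφg : ∀ lam (x : comp G (rep lam)), φ (ρ (g lam) x) = ρ (g lam) (χ (rep lam) x) := by
    intro lam x
    rw [← hfg]
    obtain ⟨v, -, hv⟩ := (hg lam).mem x.2
    rw [← hv, hφ, projV_inclV]
  refine ⟨φ, isAnosov_iff.2 fun θ hθ => ?_, fun h => lieEquiv_ext fun v => ?_⟩
  · rcases mem_aroots_of_glued hg hχs hφg hθ with ⟨lam, hlam⟩ | ⟨a, b, hab, μ, hμ, ν, hν, rfl⟩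
    · obtain ⟨α, hα, rfl⟩ := hχroots lam θ hlam
      refine ⟨?_, (hunit lam α hα).pow _⟩
      rw [norm_pow, Ne, pow_eq_one_iff_of_nonneg (norm_nonneg _) (pow_pos hN0 _).ne']
      exact hnorm lam α hα
    · obtain ⟨α, hα, rfl⟩ := hχroots _ μ hμ
      obtain ⟨β, hβ, rfl⟩ := hχroots _ ν hν
      refine ⟨?_, ((hunit _ α hα).pow _).mul ((hunit _ β hβ).pow _)⟩
      rw [norm_mul, norm_pow, norm_pow]
      by_cases hr : rep (toComponent G b) = rep (toComponent G a)
      · have hb := hg (toComponent G b)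
        rw [hr] at hb hβ ⊢
        have h2 := hhyp (rep (toComponent G a))
        rw [cNumber, if_pos ⟨a, b, ⟨_, hg _⟩, ⟨_, hb⟩, hab⟩] at h2
        rw [← mul_pow, Ne, pow_eq_one_iff_of_nonneg (by positivity) (pow_pos hN0 _).ne']
        exact (isHyperbolicOfClass_two_iff.1 h2).2 α hα β hβ
      · exact hN α (Set.mem_iUnion.2 ⟨_, hα⟩) β (Set.mem_iUnion.2 ⟨_, hβ⟩) _ _
          fun h => hr (he h).symm
  · change φ (ρ h (inclV G v)) = ρ h (φ (inclV G v))
    rw [map_inclV_of_mem_levi (hρ h), hφ, hφ, map_inclV_of_mem_levi (hρ h)]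
    exact congrArg (inclV G) (LinearMap.congr_fun (hfcomm h) v)

end Sufficiency

end GraphLie

theorem mainTheorem3 {S : Type*} [Fintype S] [DecidableEq S] (G : SimpleGraph S)
    {H : Type*} [Group H] [Finite H]
    (ρ : H →* (GraphLie.LieAlg G ≃ₗ⁅ℚ⁆ GraphLie.LieAlg G))
    (hρ : ∀ h : H, ρ h ∈ GraphLie.levi G) :
    (∃ φ : GraphLie.LieAlg G ≃ₗ⁅ℚ⁆ GraphLie.LieAlg G,
        IsAnosov φ ∧ ∀ h : H, Commute φ (ρ h)) ↔
      ∀ lam : GraphLie.Component G,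
        ∃ ψ : GraphLie.comp G lam ≃ₗ[ℚ] GraphLie.comp G lam,
          IsHyperbolicOfClass (GraphLie.cNumber ρ lam)
            (ψ : GraphLie.comp G lam →ₗ[ℚ] GraphLie.comp G lam) ∧
          IsIntegerLike (ψ : GraphLie.comp G lam →ₗ[ℚ] GraphLie.comp G lam) ∧
          ∀ h : GraphLie.stab ρ lam, Commute ψ (GraphLie.stabRep ρ lam h) := by
  refine ⟨fun ⟨φ, hφ, hcomm⟩ lam => GraphLie.exists_of_isAnosov hρ hφ hcomm lam, fun h => ?_⟩
  choose ψ hhyp hint hcomm using h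
  exact GraphLie.exists_isAnosov hρ ψ hhyp hint hcomm
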